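/- Let $\mathcal C$ be an additive bicategory: each $\mathcal C(a,b)$ is an additive category and horizontal composition $\times$ of 2-cells is biadditive. Vertical composition is $\circ$; coherence isomorphisms $\alpha,\lambda,\rho$ are suppressed, and a 1-cell also denotes its identity 2-cell. Let $\iota$ be a Frobenius 1-morphism with two-sided dual $\bar\iota$, i.e. let $\mathrm{ev}_L:\bar\iota\times\iota\to 1$, $\mathrm{coev}_L:1\to\iota\times\bar\iota$, $\mathrm{ev}_R:\iota\times\bar\iota\to 1$, $\mathrm{coev}_R:1\to\bar\iota\times\iota$ be 2-cells with $$(\iota\times \mathrm{ev}_L)\circ(\mathrm{coev}_L\times\iota)=\iota,\quad (\mathrm{ev}_L\times\bar\iota)\circ(\bar\iota\times\mathrm{coev}_L)=\bar\iota,\quad (\mathrm{ev}_R\times\iota)\circ(\iota\times\mathrm{coev}_R)=\iota,\quad (\bar\iota\times\mathrm{ev}_R)\circ(\mathrm{coev}_R\times\bar\iota)=\bar\iota .$$ Assume the (left) depth 2 condition: $(\iota\times\bar\iota)\times\iota$ is a direct summand (a retract) of a finite direct sum of copies of $\iota$. Let $A=\mathrm{End}(\iota\times\bar\iota)$, $B=\mathrm{End}(\bar\iota\times\iota)$,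 $L=\mathrm{End}(\iota)$, $R=\mathrm{End}(\bar\iota)$, rings under $\circ$, and put - $a_1*a_2=(\iota\times\mathrm{ev}_L\times\bar\iota)\circ(a_1\times a_2)\circ(\iota\times\mathrm{coev}_R\times\bar\iota)$ on $A$ and $b_1*b_2=(\bar\iota\times\mathrm{ev}_R\times\iota)\circ(b_1\times b_2)\circ(\bar\iota\times\mathrm{coev}_L\times\iota)$ on $B$; - $\mathcal F,\dot{\mathcal F}:A\to B$, $\mathcal F(a)=(\bar\iota\times\iota\times\mathrm{ev}_L)\circ(\bar\iota\times a\times\iota)\circ(\mathrm{coev}_R\times\bar\iota\times\iota)$, $\dot{\mathcal F}(a)=(\mathrm{ev}_L\times\bar\iota\times\iota)\circ(\bar\iota\times a\times\iota)\circ(\bar\iota\times\iota\times\mathrm{coev}_R)$; - $\mu,\nu:L\to R^{op}$, $\mu(l)=(\mathrm{ev}_L\times\bar\iota)\circ(\bar\iota\times l\times\bar\iota)\circ(\bar\iota\times\mathrm{coev}_L)$, $\nu(l)=(\bar\iota\times\mathrm{ev}_R)\circ(\bar\iota\times l\times\bar\iota)\circ(\mathrm{coev}_R\times\bar\iota)$;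 - $\phi_L:A\to L$, $\phi_L(a)=(\iota\times\mathrm{ev}_L)\circ(a\times\iota)\circ(\iota\times\mathrm{coev}_R)$, and $i_A=\mathrm{coev}_L\circ\mathrm{ev}_R\in A$. A D2 quasi-basis is a finite family of pairs $y_i,x_i\in A$ with $\sum_i (y_i\times\iota)\circ(\iota\times\mathrm{coev}_R)\circ(\iota\times\mathrm{ev}_L)\circ(x_i\times\iota)=(\iota\times\bar\iota)\times\iota$. Recall that a left bialgebroid $(A,L,s_L,t_L,\gamma_L,\pi_L)$ consists of rings $A,L$, ring homomorphisms $s_L:L\to A$, $t_L:L^{op}\to A$ with commuting images, and a comonoid $(A,\gamma_L,\pi_L)$ in $L$-$L$-bimodules, where $l\cdot a\cdot l'=s_L(l)t_L(l')a$ and $\gamma_L(a)=a_{(1)}\otimes a_{(2)}\in A_L\otimes{}_LA$, such that $a_{(1)}t_L(l)\otimes a_{(2)}=a_{(1)}\otimes a_{(2)}s_L(l)$, $\gamma_L$ is multiplicative and unital, $\pi_L(1)=1$, $\pi_L(a\,s_L\pi_L(b))=\pi_L(ab)=\pi_L(a\,t_L\pi_L(b))$. A right bialgebroid $(A,R,s_R,t_R,\gamma_R,\pi_R)$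 is the mirror notion, with $r\cdot a\cdot r'=a\,s_R(r')t_R(r)$ and $\gamma_R(a)=a^{(1)}\otimes a^{(2)}\in A^R\otimes{}^RA$. A Hopf algebroid is a left and a right bialgebroid on the same ring $A$ with $R\cong L^{op}$ and an additive bijection $S:A\to A$ such that $s_L(L)=t_R(R)$, $t_L(L)=s_R(R)$; $(\gamma_L\otimes\mathrm{id})\gamma_R=(\mathrm{id}\otimes\gamma_R)\gamma_L$, $(\gamma_R\otimes\mathrm{id})\gamma_L=(\mathrm{id}\otimes\gamma_L)\gamma_R$; $S(t_L(l)a\,t_L(l'))=s_L(l')S(a)s_L(l)$, $S(t_R(r')a\,t_R(r))=s_R(r)S(a)s_R(r')$; $S(a_{(1)})a_{(2)}=s_R\pi_R(a)$, $a^{(1)}S(a^{(2)})=s_L\pi_L(a)$. Then $\mathcal F,\dot{\mathcal F}$ are additive bijections, $\mu,\nu$ are ring isomorphisms, $\iota$ is depth 2 also on the right ($(\bar\iota\times\iota)\times\bar\iota$ is a direct summand of a finite direct sum of copies of $\bar\iota$), D2 quasi-bases exist, and for every D2 quasi-basis $(y_i,x_i)$: (1) with $S_A=\dot{\mathcal F}^{-1}\circ\mathcal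 F$, the maps $$\begin{array}{ll} s_L(l)=l\times\bar\iota, & t_L(l)=\iota\times\mu(l),\\ \gamma_L(a)=\sum_i a*S_A^{-1}(y_i)\otimes x_i=\sum_i S_A^{-1}(y_i)\otimes x_i*a, & \pi_L(a)=\phi_L(a\circ i_A),\\ s_R(r)=\iota\times r, & t_R(r)=\nu^{-1}(r)\times\bar\iota,\\ \gamma_R(a)=\sum_i a*S_A(x_i)\otimes y_i=\sum_i S_A(x_i)\otimes y_i*a, & \pi_R(a)=\nu(\phi_L(S_A^{-1}(a)\circ i_A))\end{array}$$ are a left bialgebroid structure over $L$ and a right bialgebroid structure over $R$ on $A$ which, together with the antipode $S_A$, form a Hopf algebroid; (2) with $S_B=\mathcal F\circ\dot{\mathcal F}^{-1}$, the maps $$\begin{array}{ll} s_L(r)=r\times\iota, & t_L(r)=\bar\iota\times\nu^{-1}(r),\\ \gamma_L(b)=\sum_i b*\mathcal F(x_i)\otimes \mathcal F(y_i)=\sum_i \mathcal F(x_i)\otimes \mathcal F(y_i)*b, & \pi_L(b)=\nu(\phi_L(\mathcal F^{-1}(b))),\\ s_R(l)=\bar\iota\times l, & t_R(l)=\mu(l)\times\iota,\\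 \gamma_R(b)=\sum_i b*\dot{\mathcal F}(y_i)\otimes \dot{\mathcal F}(x_i)=\sum_i \dot{\mathcal F}(y_i)\otimes\dot{\mathcal F}(x_i)*b, & \pi_R(b)=\phi_L(\dot{\mathcal F}^{-1}(b))\end{array}$$ are a left bialgebroid structure over $R$ and a right bialgebroid structure over $L$ on $B$ which, together with the antipode $S_B$, form a Hopf algebroid. -/

import Mathlib

open CategoryTheory CategoryTheory.Limits MulOpposite
open scoped TensorProduct Bicategory

universe w v u

/-! ### Balanced tensor products over noncommutative rings

`ρ : R → M → M` is the right action and `lam : R → N → N` the left action of `R` that are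
balanced against each other. They are passed explicitly because one ring `A` carries several
module structures at the same time. -/

section Balanced

variable {R R' M N P : Type*} [AddCommGroup M] [AddCommGroup N] [AddCommGroup P]

/-- The relations `(m · r) ⊗ n = m ⊗ (r · n)`. -/
def balRel (ρ : R → M → M) (lam : R → N → N) : AddSubgroup (M ⊗[ℤ] N) :=
  AddSubgroup.closure {z | ∃ (r : R) (m : M) (n : N), z = ρ r m ⊗ₜ[ℤ] n - m ⊗ₜ[ℤ] lam r n}

/-- The tensor product `M ⊗_R N`, an additive group. -/
abbrev Bal (ρ : R → M → M) (lam : R → N → N) : Type _ := (M ⊗[ℤ] N) ⧸ balRel ρ lam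

/-- The element `m ⊗ n` of `M ⊗_R N`. -/
def Bal.tmul {ρ : R → M → M} {lam : R → N → N} (m : M) (n : N) : Bal ρ lam :=
  QuotientAddGroup.mk' (balRel ρ lam) (m ⊗ₜ[ℤ] n)

/-- Every element of `M ⊗_R N` is a finite sum of elements `m ⊗ n`. -/
theorem Bal.exists_rep {ρ : R → M → M} {lam : R → N → N} (z : Bal ρ lam) :
    ∃ (n : ℕ) (p : Fin n → M) (q : Fin n → N), z = ∑ i, Bal.tmul (p i) (q i) := by
  obtain ⟨w, rfl⟩ := QuotientAddGroup.mk'_surjective (balRel ρ lam) z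
  induction w with
  | zero => exact ⟨0, Fin.elim0, Fin.elim0, by simp⟩
  | tmul m n => exact ⟨1, fun _ => m, fun _ => n, by simp [Bal.tmul]⟩
  | add x y hx hy =>
    obtain ⟨n, p, q, h⟩ := hx
    obtain ⟨n', p', q', h'⟩ := hy
    refine ⟨n + n', Fin.append p p', Fin.append q q', ?_⟩
    rw [map_add, h, h', Fin.sum_univ_add]
    simp

/-- The relations of a triple tensor product `M ⊗_R N ⊗_R' P`. -/
def balRel₃ (ρ₁ : R → M → M) (lam₂ : R → N → N) (ρ₂ : R' → N → N) (lam₃ : R' → P → P) :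
    AddSubgroup (M ⊗[ℤ] (N ⊗[ℤ] P)) :=
  AddSubgroup.closure
    ({z | ∃ (r : R) (m : M) (n : N) (p : P),
        z = ρ₁ r m ⊗ₜ[ℤ] (n ⊗ₜ[ℤ] p) - m ⊗ₜ[ℤ] (lam₂ r n ⊗ₜ[ℤ] p)} ∪
      {z | ∃ (r : R') (m : M) (n : N) (p : P),
        z = m ⊗ₜ[ℤ] (ρ₂ r n ⊗ₜ[ℤ] p) - m ⊗ₜ[ℤ] (n ⊗ₜ[ℤ] lam₃ r p)})

/-- The triple tensor product `M ⊗_R N ⊗_R' P`. -/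
abbrev Bal₃ (ρ₁ : R → M → M) (lam₂ : R → N → N) (ρ₂ : R' → N → N) (lam₃ : R' → P → P) :
    Type _ := (M ⊗[ℤ] (N ⊗[ℤ] P)) ⧸ balRel₃ ρ₁ lam₂ ρ₂ lam₃

/-- The map `z ↦ z ⊗ p` from `M ⊗_R N` to `M ⊗_R N ⊗_R' P`. -/
def Bal.tmulRight {ρ₁ : R → M → M} {lam₂ : R → N → N} {ρ₂ : R' → N → N} {lam₃ : R' → P → P}
    (z : Bal ρ₁ lam₂) (p : P) : Bal₃ ρ₁ lam₂ ρ₂ lam₃ :=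
  QuotientAddGroup.lift (balRel ρ₁ lam₂)
    ((QuotientAddGroup.mk' (balRel₃ ρ₁ lam₂ ρ₂ lam₃)).comp
      (((TensorProduct.mk ℤ N P).flip p).lTensor M).toAddMonoidHom)
    ((AddSubgroup.closure_le _).2 (by
      rintro _ ⟨r, m, n, rfl⟩
      refine (QuotientAddGroup.eq_zero_iff _).2 (AddSubgroup.subset_closure (Or.inl ⟨r, m, n, p, ?_⟩))
      exact map_sub (((TensorProduct.mk ℤ N P).flip p).lTensor M).toAddMonoidHom
        (ρ₁ r m ⊗ₜ[ℤ] n) (m ⊗ₜ[ℤ] lam₂ r n))) z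

/-- The map `z ↦ m ⊗ z` from `N ⊗_R' P` to `M ⊗_R N ⊗_R' P`. -/
def Bal.tmulLeft {ρ₁ : R → M → M} {lam₂ : R → N → N} {ρ₂ : R' → N → N} {lam₃ : R' → P → P}
    (m : M) (z : Bal ρ₂ lam₃) : Bal₃ ρ₁ lam₂ ρ₂ lam₃ :=
  QuotientAddGroup.lift (balRel ρ₂ lam₃)
    ((QuotientAddGroup.mk' (balRel₃ ρ₁ lam₂ ρ₂ lam₃)).comp
      (TensorProduct.mk ℤ M (N ⊗[ℤ] P) m).toAddMonoidHom)
    ((AddSubgroup.closure_le _).2 (by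
      rintro _ ⟨r, n, p, rfl⟩
      refine (QuotientAddGroup.eq_zero_iff _).2 (AddSubgroup.subset_closure (Or.inr ⟨r, m, n, p, ?_⟩))
      simp [TensorProduct.tmul_sub])) z

end Balanced

/-! ### Bialgebroids and Hopf algebroids

Sweedler notation is spelled out: `γ a = ∑ i, p i ⊗ q i` stands for `γ(a) = a₍₁₎ ⊗ a₍₂₎`, and an
axiom in Sweedler notation is required for every way of writing `γ a` as such a sum. (The other
axioms make the expressions independent of that choice.) -/

section Bialgebroid

variable {A L R : Type*} [Ring A] [Ring L] [Ring R]

/-- The right `L`-module `A_L`: `a · l = t(l) a`. -/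
def actAL (t : Lᵐᵒᵖ →+* A) (l : L) (a : A) : A := t (op l) * a

/-- The left `L`-module `_L A`: `l · a = s(l) a`. -/
def actLA (s : L →+* A) (l : L) (a : A) : A := s l * a

/-- The right `R`-module `A^R`: `a · r = a s(r)`. -/
def actAR (s : R →+* A) (r : R) (a : A) : A := a * s r

/-- The left `R`-module `^R A`: `r · a = a t(r)`. -/
def actRA (t : Rᵐᵒᵖ →+* A) (r : R) (a : A) : A := a * t (op r)

end Bialgebroid

/-- A left bialgebroid with total ring `A` and base ring `L`. -/
structure LeftBialgebroid (A L : Type*) [Ring A] [Ring L] where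
  /-- source map -/
  s : L →+* A
  /-- target map -/
  t : Lᵐᵒᵖ →+* A
  /-- coproduct `A → A_L ⊗ _L A` -/
  γ : A →+ Bal (actAL t) (actLA s)
  /-- counit -/
  π : A →+ L
  comm : ∀ l l' : L, s l * t (op l') = t (op l') * s l
  -- `γ` and `π` are maps of `L`-`L` bimodules, for `l · a · l' = s(l) t(l') a`
  γ_left : ∀ (l : L) (a : A) (n : ℕ) (p q : Fin n → A), γ a = ∑ i, Bal.tmul (p i) (q i) →
    γ (s l * a) = ∑ i, Bal.tmul (s l * p i) (q i)
  γ_right : ∀ (l : L) (a : A) (n : ℕ) (p q : Fin n → A), γ a = ∑ i, Bal.tmul (p i) (q i) →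
    γ (t (op l) * a) = ∑ i, Bal.tmul (p i) (t (op l) * q i)
  π_left : ∀ (l : L) (a : A), π (s l * a) = l * π a
  π_right : ∀ (l : L) (a : A), π (t (op l) * a) = π a * l
  -- comonoid axioms: `(γ ⊗ id) ∘ γ = (id ⊗ γ) ∘ γ` in `A_L ⊗ _L A_L ⊗ _L A`, and the counit laws
  coassoc : ∀ (a : A) (n : ℕ) (p q : Fin n → A), γ a = ∑ i, Bal.tmul (p i) (q i) →
    (∑ i, Bal.tmulRight (γ (p i)) (q i) : Bal₃ (actAL t) (actLA s) (actAL t) (actLA s)) =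
      ∑ i, Bal.tmulLeft (p i) (γ (q i))
  counit_left : ∀ (a : A) (n : ℕ) (p q : Fin n → A), γ a = ∑ i, Bal.tmul (p i) (q i) →
    ∑ i, s (π (p i)) * q i = a
  counit_right : ∀ (a : A) (n : ℕ) (p q : Fin n → A), γ a = ∑ i, Bal.tmul (p i) (q i) →
    ∑ i, t (op (π (q i))) * p i = a
  -- compatibility with the ring structure of `A`
  γ_cross : ∀ (l : L) (a : A) (n : ℕ) (p q : Fin n → A), γ a = ∑ i, Bal.tmul (p i) (q i) →
    (∑ i, Bal.tmul (p i * t (op l)) (q i) : Bal (actAL t) (actLA s)) =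
      ∑ i, Bal.tmul (p i) (q i * s l)
  γ_one : γ 1 = Bal.tmul 1 1
  γ_mul : ∀ (a b : A) (n : ℕ) (p q : Fin n → A) (m : ℕ) (p' q' : Fin m → A),
    γ a = ∑ i, Bal.tmul (p i) (q i) → γ b = ∑ j, Bal.tmul (p' j) (q' j) →
    γ (a * b) = ∑ i, ∑ j, Bal.tmul (p i * p' j) (q i * q' j)
  π_one : π 1 = 1
  π_mul_s : ∀ a b : A, π (a * s (π b)) = π (a * b)
  π_mul_t : ∀ a b : A, π (a * t (op (π b))) = π (a * b)

/-- A right bialgebroid with total ring `A` and base ring `R`. -/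
structure RightBialgebroid (A R : Type*) [Ring A] [Ring R] where
  /-- source map -/
  s : R →+* A
  /-- target map -/
  t : Rᵐᵒᵖ →+* A
  /-- coproduct `A → A^R ⊗ ^R A` -/
  γ : A →+ Bal (actAR s) (actRA t)
  /-- counit -/
  π : A →+ R
  comm : ∀ r r' : R, s r * t (op r') = t (op r') * s r
  -- `γ` and `π` are maps of `R`-`R` bimodules, for `r · a · r' = a s(r') t(r)`
  γ_left : ∀ (r : R) (a : A) (n : ℕ) (p q : Fin n → A), γ a = ∑ i, Bal.tmul (p i) (q i) →
    γ (a * t (op r)) = ∑ i, Bal.tmul (p i * t (op r)) (q i)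
  γ_right : ∀ (r : R) (a : A) (n : ℕ) (p q : Fin n → A), γ a = ∑ i, Bal.tmul (p i) (q i) →
    γ (a * s r) = ∑ i, Bal.tmul (p i) (q i * s r)
  π_left : ∀ (r : R) (a : A), π (a * t (op r)) = r * π a
  π_right : ∀ (r : R) (a : A), π (a * s r) = π a * r
  -- comonoid axioms: `(γ ⊗ id) ∘ γ = (id ⊗ γ) ∘ γ` in `A^R ⊗ ^R A^R ⊗ ^R A`, and the counit laws
  coassoc : ∀ (a : A) (n : ℕ) (p q : Fin n → A), γ a = ∑ i, Bal.tmul (p i) (q i) →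
    (∑ i, Bal.tmulRight (γ (p i)) (q i) : Bal₃ (actAR s) (actRA t) (actAR s) (actRA t)) =
      ∑ i, Bal.tmulLeft (p i) (γ (q i))
  counit_left : ∀ (a : A) (n : ℕ) (p q : Fin n → A), γ a = ∑ i, Bal.tmul (p i) (q i) →
    ∑ i, q i * t (op (π (p i))) = a
  counit_right : ∀ (a : A) (n : ℕ) (p q : Fin n → A), γ a = ∑ i, Bal.tmul (p i) (q i) →
    ∑ i, p i * s (π (q i)) = a
  -- compatibility with the ring structure of `A`
  γ_cross : ∀ (r : R) (a : A) (n : ℕ) (p q : Fin n → A), γ a = ∑ i, Bal.tmul (p i) (q i) →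
    (∑ i, Bal.tmul (s r * p i) (q i) : Bal (actAR s) (actRA t)) =
      ∑ i, Bal.tmul (p i) (t (op r) * q i)
  γ_one : γ 1 = Bal.tmul 1 1
  γ_mul : ∀ (a b : A) (n : ℕ) (p q : Fin n → A) (m : ℕ) (p' q' : Fin m → A),
    γ a = ∑ i, Bal.tmul (p i) (q i) → γ b = ∑ j, Bal.tmul (p' j) (q' j) →
    γ (a * b) = ∑ i, ∑ j, Bal.tmul (p i * p' j) (q i * q' j)
  π_one : π 1 = 1
  π_s_mul : ∀ a b : A, π (s (π a) * b) = π (a * b)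
  π_t_mul : ∀ a b : A, π (t (op (π a)) * b) = π (a * b)

/-- A Hopf algebroid in the sense of Böhm and Szlachányi: a left bialgebroid over `L` and a right
bialgebroid over `R` on the same ring `A`, with an antipode `S`. -/
structure HopfAlgebroid (A L R : Type*) [Ring A] [Ring L] [Ring R] where
  left : LeftBialgebroid A L
  right : RightBialgebroid A R
  /-- antipode -/
  S : A ≃+ A
  base : Nonempty (R ≃+* Lᵐᵒᵖ)
  range_s_left : left.s.range = right.t.range
  range_t_left : left.t.range = right.s.range
  -- `(γ_L ⊗ id) ∘ γ_R = (id ⊗ γ_R) ∘ γ_L` in `A_L ⊗ _L A^R ⊗ ^R A`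
  coassoc_left_right : ∀ (a : A) (n : ℕ) (p q : Fin n → A) (m : ℕ) (p' q' : Fin m → A),
    right.γ a = ∑ i, Bal.tmul (p i) (q i) → left.γ a = ∑ j, Bal.tmul (p' j) (q' j) →
    (∑ i, Bal.tmulRight (left.γ (p i)) (q i) :
        Bal₃ (actAL left.t) (actLA left.s) (actAR right.s) (actRA right.t)) =
      ∑ j, Bal.tmulLeft (p' j) (right.γ (q' j))
  -- `(γ_R ⊗ id) ∘ γ_L = (id ⊗ γ_L) ∘ γ_R` in `A^R ⊗ ^R A_L ⊗ _L A`
  coassoc_right_left : ∀ (a : A) (n : ℕ) (p q : Fin n → A) (m : ℕ) (p' q' : Fin m → A),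
    left.γ a = ∑ i, Bal.tmul (p i) (q i) → right.γ a = ∑ j, Bal.tmul (p' j) (q' j) →
    (∑ i, Bal.tmulRight (right.γ (p i)) (q i) :
        Bal₃ (actAR right.s) (actRA right.t) (actAL left.t) (actLA left.s)) =
      ∑ j, Bal.tmulLeft (p' j) (left.γ (q' j))
  S_left : ∀ (l l' : L) (a : A),
    S (left.t (op l) * a * left.t (op l')) = left.s l' * S a * left.s l
  S_right : ∀ (r r' : R) (a : A),
    S (right.t (op r') * a * right.t (op r)) = right.s r * S a * right.s r'
  -- `S(a₍₁₎) a₍₂₎ = s_R(π_R(a))` and `a⁽¹⁾ S(a⁽²⁾) = s_L(π_L(a))`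
  antipode_left : ∀ (a : A) (n : ℕ) (p q : Fin n → A), left.γ a = ∑ i, Bal.tmul (p i) (q i) →
    ∑ i, S (p i) * q i = right.s (right.π a)
  antipode_right : ∀ (a : A) (n : ℕ) (p q : Fin n → A), right.γ a = ∑ i, Bal.tmul (p i) (q i) →
    ∑ i, p i * S (q i) = left.s (left.π a)

/-! ### Additive bicategories, Frobenius 1-morphisms, depth 2 -/

/-- A bicategory enriched over abelian groups: vertical and horizontal composition are biadditive. -/
class PreadditiveBicategory (C : Type u) [Bicategory.{w, v} C] where
  preadditive : ∀ a b : C, Preadditive (a ⟶ b)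
  whiskerLeft_add : ∀ {a b c : C} (f : a ⟶ b) {g h : b ⟶ c} (η θ : g ⟶ h),
    f ◁ (η + θ) = f ◁ η + f ◁ θ
  add_whiskerRight : ∀ {a b c : C} {f g : a ⟶ b} (η θ : f ⟶ g) (h : b ⟶ c),
    (η + θ) ▷ h = η ▷ h + θ ▷ h

attribute [reducible, instance] PreadditiveBicategory.preadditive

/-- An additive bicategory: moreover there are zero 1-morphisms and direct sums of 1-morphisms. -/
class AdditiveBicategory (C : Type u) [Bicategory.{w, v} C] extends PreadditiveBicategory C where
  hasFiniteBiproducts : ∀ a b : C, HasFiniteBiproducts (a ⟶ b)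

attribute [instance] AdditiveBicategory.hasFiniteBiproducts

section Frobenius

variable {C : Type u} [Bicategory.{w, v} C] {a b : C}

/-- `ῑ` is a two-sided dual of `ι`, with chosen duality 2-morphisms. The horizontal composite
`ι × ῑ` is written `ι ≫ ῑ` (left to right), and `x ∘ y` is `y ≫ x`. -/
structure TwoSidedDual (ι : a ⟶ b) (ῑ : b ⟶ a) where
  left : Bicategory.Adjunction ι ῑ
  right : Bicategory.Adjunction ῑ ι

namespace TwoSidedDual

variable {ι : a ⟶ b} {ῑ : b ⟶ a} (D : TwoSidedDual ι ῑ)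

/-- `ev_L : ῑ × ι → 1` -/
def evL : ῑ ≫ ι ⟶ 𝟙 b := D.left.counit

/-- `coev_L : 1 → ι × ῑ` -/
def coevL : 𝟙 a ⟶ ι ≫ ῑ := D.left.unit

/-- `ev_R : ι × ῑ → 1` -/
def evR : ι ≫ ῑ ⟶ 𝟙 a := D.right.counit

/-- `coev_R : 1 → ῑ × ι` -/
def coevR : 𝟙 b ⟶ ῑ ≫ ι := D.right.unit

/-- The convolution product on `A = End (ι × ῑ)`. -/
def convA (a₁ a₂ : End (ι ≫ ῑ)) : End (ι ≫ ῑ) :=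
  (ρ_ ι).inv ▷ ῑ ≫ (ι ◁ D.coevR) ▷ ῑ ≫ (α_ ι ῑ ι).inv ▷ ῑ ≫ (α_ (ι ≫ ῑ) ι ῑ).hom ≫
    (a₁ ▷ (ι ≫ ῑ) ≫ (ι ≫ ῑ) ◁ a₂) ≫
    (α_ (ι ≫ ῑ) ι ῑ).inv ≫ (α_ ι ῑ ι).hom ▷ ῑ ≫ (ι ◁ D.evL) ▷ ῑ ≫ (ρ_ ι).hom ▷ ῑ

/-- The convolution product on `B = End (ῑ × ι)`. -/
def convB (b₁ b₂ : End (ῑ ≫ ι)) : End (ῑ ≫ ι) :=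
  ῑ ◁ (λ_ ι).inv ≫ ῑ ◁ (D.coevL ▷ ι) ≫ ῑ ◁ (α_ ι ῑ ι).hom ≫ (α_ ῑ ι (ῑ ≫ ι)).inv ≫
    (b₁ ▷ (ῑ ≫ ι) ≫ (ῑ ≫ ι) ◁ b₂) ≫
    (α_ ῑ ι (ῑ ≫ ι)).hom ≫ ῑ ◁ (α_ ι ῑ ι).inv ≫ ῑ ◁ (D.evR ▷ ι) ≫ ῑ ◁ (λ_ ι).hom

/-- The Fourier transform `F : A → B`. -/
def fourier (x : End (ι ≫ ῑ)) : End (ῑ ≫ ι) :=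
  (λ_ (ῑ ≫ ι)).inv ≫ D.coevR ▷ (ῑ ≫ ι) ≫ (α_ (ῑ ≫ ι) ῑ ι).inv ≫ (α_ ῑ ι ῑ).hom ▷ ι ≫
    (ῑ ◁ x) ▷ ι ≫
    (α_ ῑ ι ῑ).inv ▷ ι ≫ (α_ (ῑ ≫ ι) ῑ ι).hom ≫ (ῑ ≫ ι) ◁ D.evL ≫ (ρ_ (ῑ ≫ ι)).hom

/-- The dotted Fourier transform `Ḟ : A → B`. -/
def fourierDot (x : End (ι ≫ ῑ)) : End (ῑ ≫ ι) :=
  (ρ_ (ῑ ≫ ι)).inv ≫ (ῑ ≫ ι) ◁ D.coevR ≫ (α_ ῑ ι (ῑ ≫ ι)).hom ≫ ῑ ◁ (α_ ι ῑ ι).inv ≫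
    ῑ ◁ (x ▷ ι) ≫
    ῑ ◁ (α_ ι ῑ ι).hom ≫ (α_ ῑ ι (ῑ ≫ ι)).inv ≫ D.evL ▷ (ῑ ≫ ι) ≫ (λ_ (ῑ ≫ ι)).hom

/-- The map `μ` from `L = End ι` to `R = End ῑ`. -/
def mu (l : End ι) : End ῑ :=
  (ρ_ ῑ).inv ≫ ῑ ◁ D.coevL ≫ (α_ ῑ ι ῑ).inv ≫ (ῑ ◁ l) ▷ ῑ ≫ D.evL ▷ ῑ ≫ (λ_ ῑ).hom

/-- The map `ν` from `L = End ι` to `R = End ῑ`. -/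
def nu (l : End ι) : End ῑ :=
  (λ_ ῑ).inv ≫ D.coevR ▷ ῑ ≫ (α_ ῑ ι ῑ).hom ≫ ῑ ◁ (l ▷ ῑ) ≫ ῑ ◁ D.evR ≫ (ρ_ ῑ).hom

/-- The Frobenius map `φ_L : A → L`. -/
def phiL (x : End (ι ≫ ῑ)) : End ι :=
  (ρ_ ι).inv ≫ ι ◁ D.coevR ≫ (α_ ι ῑ ι).inv ≫ x ▷ ι ≫ (α_ ι ῑ ι).hom ≫ ι ◁ D.evL ≫ (ρ_ ι).hom

/-- The element `i_A = coev_L ∘ ev_R` of `A`. -/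
def iA : End (ι ≫ ῑ) := D.evR ≫ D.coevL

/-- `∑ᵢ yᵢ ⊗ xᵢ` is a D2 quasi-basis for `ι`. -/
def IsQuasiBasis [PreadditiveBicategory C] {n : ℕ} (y x : Fin n → End (ι ≫ ῑ)) : Prop :=
  ∑ i, (x i ▷ ι ≫ (α_ ι ῑ ι).hom ≫ ι ◁ D.evL ≫ ι ◁ D.coevR ≫ (α_ ι ῑ ι).inv ≫ y i ▷ ι) =
    𝟙 ((ι ≫ ῑ) ≫ ι)

end TwoSidedDual

/-- The left depth 2 condition: `(ι × ῑ) × ι` is a direct summand (a retract) of a finite direct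
sum of copies of `ι`. -/
def IsLeftD2 [AdditiveBicategory C] (ι : a ⟶ b) (ῑ : b ⟶ a) : Prop :=
  ∃ n : ℕ, Nonempty (Retract ((ι ≫ ῑ) ≫ ι) (⨁ fun _ : Fin n => ι))

/-- Depth 2: the left condition together with the right one, that `(ῑ × ι) × ῑ` is a direct summand
of a finite direct sum of copies of `ῑ`. -/
def IsD2 [AdditiveBicategory C] (ι : a ⟶ b) (ῑ : b ⟶ a) : Prop :=
  IsLeftD2 ι ῑ ∧ IsLeftD2 ῑ ι

end Frobenius

/-!
Rotating diagrams (the Fourier transforms `F` and `Ḟ`) exchanges composition and convolution, up to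
the order of the factors. So `A` is a ring with a second product `*`, and `S = Ḟ⁻¹ ∘ F` reverses
both products. Inserting the quasi-basis identity between two convolutions gives the interchange law
`∑ᵢ ((a * S⁻¹(yᵢ)) x) * ((xᵢ * c) y) = (a * c) (x * y)`. By this law the maps
`z₁ ⊗ z₂ ↦ z₁ * (z₂ y)` jointly separate the elements of the balanced tensor product, and they send
the coproduct of `a` to `a (1 * y)`; the bialgebroid axioms thereby become identities in `A` between
the two products. The situation is self-dual: the mate of the quasi-basis identity under the
composite duality `ῑ × (ι × ῑ) ⊣ (ι × ῑ) × ι` is a quasi-basis for the duality with `ι` and `ῑ`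
exchanged, which gives both the right depth 2 condition and the Hopf algebroid on `B`.
-/

section BalancedMaps

variable {R R' M N P : Type*} [AddCommGroup M] [AddCommGroup N] [AddCommGroup P]

namespace Bal

variable {ρ : R → M → M} {lam : R → N → N}

/-- `Bal.tmul` as a biadditive map. -/
def tmulHom (ρ : R → M → M) (lam : R → N → N) : M →+ N →+ Bal ρ lam :=
  AddMonoidHom.mk' (fun m => AddMonoidHom.mk' (fun n => tmul m n) fun n n' => by
    simp [tmul, TensorProduct.tmul_add]) fun m m' => by
      ext n
      simp [tmul, TensorProduct.add_tmul]

@[simp]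
theorem tmulHom_apply (m : M) (n : N) : tmulHom ρ lam m n = tmul m n := rfl

theorem tmul_balanced (r : R) (m : M) (n : N) :
    (tmul (ρ r m) n : Bal ρ lam) = tmul m (lam r n) := by
  rw [← sub_eq_zero]
  exact (QuotientAddGroup.eq_zero_iff _).2 (AddSubgroup.subset_closure ⟨r, m, n, rfl⟩)

/-- The universal property of `M ⊗_R N`: a balanced biadditive map factors through it. -/
def lift (f : M →+ N →+ P) (hf : ∀ r m n, f (ρ r m) n = f m (lam r n)) : Bal ρ lam →+ P :=
  QuotientAddGroup.lift (balRel ρ lam)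
    (TensorProduct.liftAddHom f fun r m n => by simp)
    ((AddSubgroup.closure_le _).2 (by
      rintro _ ⟨r, m, n, rfl⟩
      simp [hf]))

@[simp]
theorem lift_tmul (f : M →+ N →+ P) (hf : ∀ r m n, f (ρ r m) n = f m (lam r n)) (m : M) (n : N) :
    lift f hf (tmul m n) = f m n :=
  rfl

theorem hom_ext {f g : Bal ρ lam →+ P} (h : ∀ m n, f (tmul m n) = g (tmul m n)) : f = g := by
  refine DFunLike.ext _ _ fun z => ?_
  obtain ⟨n, p, q, rfl⟩ := z.exists_rep
  simp only [map_sum, h]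

-- With a dual basis `(q, r)` of `N` at hand, `z = ∑ₖ c k z ⊗ q k`.
theorem ext_of_dual_basis {κ : Type*} [Fintype κ] {q : κ → N} {r : κ → N → R}
    (hq : ∀ n, ∑ k, lam (r k n) (q k) = n) (c : κ → Bal ρ lam →+ M)
    (hc : ∀ k m n, c k (tmul m n) = ρ (r k n) m) {z z' : Bal ρ lam}
    (h : ∀ k, c k z = c k z') : z = z' := by
  have reconstruct : ∑ k, ((tmulHom ρ lam).flip (q k)).comp (c k) = AddMonoidHom.id _ := by
    refine hom_ext fun m n => ?_
    simp only [AddMonoidHom.finsetSum_apply, AddMonoidHom.comp_apply, AddMonoidHom.flip_apply,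
      tmulHom_apply, hc, tmul_balanced, AddMonoidHom.id_apply]
    simp only [← tmulHom_apply, ← map_sum, hq]
  rw [← AddMonoidHom.id_apply _ z, ← AddMonoidHom.id_apply _ z', ← reconstruct]
  simp only [AddMonoidHom.finsetSum_apply, AddMonoidHom.comp_apply, h]

end Bal

namespace Bal₃

variable {ρ₁ : R → M → M} {lam₂ : R → N → N} {ρ₂ : R' → N → N} {lam₃ : R' → P → P}

/-- The element `m ⊗ n ⊗ p` of a triple tensor product, as a triadditive map. -/
def tmulHom (ρ₁ : R → M → M) (lam₂ : R → N → N) (ρ₂ : R' → N → N) (lam₃ : R' → P → P) :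
    M →+ N →+ P →+ Bal₃ ρ₁ lam₂ ρ₂ lam₃ :=
  AddMonoidHom.mk' (fun m => AddMonoidHom.mk' (fun n => AddMonoidHom.mk' (fun p =>
    QuotientAddGroup.mk' (balRel₃ ρ₁ lam₂ ρ₂ lam₃) (m ⊗ₜ[ℤ] (n ⊗ₜ[ℤ] p)))
      fun p p' => by simp [TensorProduct.tmul_add])
      fun n n' => by ext p; simp [TensorProduct.tmul_add, TensorProduct.add_tmul])
      fun m m' => by ext n p; simp [TensorProduct.add_tmul]

theorem tmulHom_balanced_left (r : R) (m : M) (n : N) (p : P) :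
    tmulHom ρ₁ lam₂ ρ₂ lam₃ (ρ₁ r m) n p = tmulHom ρ₁ lam₂ ρ₂ lam₃ m (lam₂ r n) p := by
  rw [← sub_eq_zero]
  exact (QuotientAddGroup.eq_zero_iff _).2 (AddSubgroup.subset_closure (Or.inl ⟨r, m, n, p, rfl⟩))

theorem tmulHom_balanced_right (r : R') (m : M) (n : N) (p : P) :
    tmulHom ρ₁ lam₂ ρ₂ lam₃ m (ρ₂ r n) p = tmulHom ρ₁ lam₂ ρ₂ lam₃ m n (lam₃ r p) := by
  rw [← sub_eq_zero]
  exact (QuotientAddGroup.eq_zero_iff _).2 (AddSubgroup.subset_closure (Or.inr ⟨r, m, n, p, rfl⟩))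

end Bal₃

namespace Bal

theorem tmulRight_sum_tmul {ρ₁ : R → M → M} {lam₂ : R → N → N} {ρ₂ : R' → N → N}
    {lam₃ : R' → P → P} {κ : Type*} (s : Finset κ) (m : κ → M) (n : κ → N) (p : P) :
    (tmulRight (∑ i ∈ s, tmul (m i) (n i)) p : Bal₃ ρ₁ lam₂ ρ₂ lam₃) =
      ∑ i ∈ s, Bal₃.tmulHom ρ₁ lam₂ ρ₂ lam₃ (m i) (n i) p :=
  map_sum (QuotientAddGroup.lift (balRel ρ₁ lam₂)
    ((QuotientAddGroup.mk' (balRel₃ ρ₁ lam₂ ρ₂ lam₃)).comp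
      (((TensorProduct.mk ℤ N P).flip p).lTensor M).toAddMonoidHom) _)
    (fun i => tmul (m i) (n i)) s

theorem tmulLeft_sum_tmul {ρ₁ : R → M → M} {lam₂ : R → N → N} {ρ₂ : R' → N → N}
    {lam₃ : R' → P → P} {κ : Type*} (s : Finset κ) (m : M) (n : κ → N) (p : κ → P) :
    (tmulLeft m (∑ i ∈ s, tmul (n i) (p i)) : Bal₃ ρ₁ lam₂ ρ₂ lam₃) =
      ∑ i ∈ s, Bal₃.tmulHom ρ₁ lam₂ ρ₂ lam₃ m (n i) (p i) :=
  map_sum (QuotientAddGroup.lift (balRel ρ₂ lam₃)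
    ((QuotientAddGroup.mk' (balRel₃ ρ₁ lam₂ ρ₂ lam₃)).comp
      (TensorProduct.mk ℤ M (N ⊗[ℤ] P) m).toAddMonoidHom) _)
    (fun i => tmul (n i) (p i)) s

-- Both sides equal `∑ⱼ ∑ₖ p₁ j ⊗ (q₁ j * a * p₂ k) ⊗ q₂ k`, where `*` is `conv`.
theorem mixed_coassoc {A : Type*} [AddCommGroup A] {ρ₁ lam₂ : R → A → A} {ρ₂ lam₃ : R' → A → A}
    (conv : A →+ A →+ A) (conv_assoc : ∀ x y z, conv (conv x y) z = conv x (conv y z))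
    (conv_ρ₂ : ∀ r x y, conv x (ρ₂ r y) = ρ₂ r (conv x y))
    (lam₂_conv : ∀ r x y, conv (lam₂ r x) y = lam₂ r (conv x y))
    {γ₁ : A → Bal ρ₁ lam₂} {γ₂ : A → Bal ρ₂ lam₃}
    {κ₁ κ₂ : Type*} [Fintype κ₁] [Fintype κ₂] {p₁ q₁ : κ₁ → A} {p₂ q₂ : κ₂ → A}
    (hγ₁ : ∀ z, γ₁ z = ∑ j, tmul (p₁ j) (conv (q₁ j) z))
    (hγ₂ : ∀ z, γ₂ z = ∑ k, tmul (conv z (p₂ k)) (q₂ k))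
    (a : A) {n m : ℕ} {p q : Fin n → A} {p' q' : Fin m → A}
    (h₂ : γ₂ a = ∑ i, tmul (p i) (q i)) (h₁ : γ₁ a = ∑ i, tmul (p' i) (q' i)) :
    (∑ i, tmulRight (γ₁ (p i)) (q i) : Bal₃ ρ₁ lam₂ ρ₂ lam₃) =
      ∑ i, tmulLeft (p' i) (γ₂ (q' i)) := by
  let T := Bal₃.tmulHom ρ₁ lam₂ ρ₂ lam₃
  let applyγ₁ : Bal ρ₂ lam₃ →+ Bal₃ ρ₁ lam₂ ρ₂ lam₃ :=
    lift (∑ j, (T (p₁ j)).comp (conv (q₁ j))) fun r x y => by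
      simp only [AddMonoidHom.finsetSum_apply, AddMonoidHom.comp_apply, conv_ρ₂]
      exact Finset.sum_congr rfl fun j _ => Bal₃.tmulHom_balanced_right _ _ _ _
  let applyγ₂ : Bal ρ₁ lam₂ →+ Bal₃ ρ₁ lam₂ ρ₂ lam₃ :=
    lift (∑ k, (AddMonoidHom.compHom.flip (conv.flip (p₂ k))).comp (T.compr₂ (.eval (q₂ k))))
      fun r x y => by
        simp only [AddMonoidHom.finsetSum_apply, AddMonoidHom.comp_apply,
          AddMonoidHom.flip_apply, AddMonoidHom.compHom_apply_apply, AddMonoidHom.compr₂_apply,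
          lam₂_conv]
        exact Finset.sum_congr rfl fun k _ => Bal₃.tmulHom_balanced_left _ _ _ _
  have left := congrArg applyγ₁ (h₂.symm.trans (hγ₂ a))
  have right := congrArg applyγ₂ (h₁.symm.trans (hγ₁ a))
  simp only [map_sum, applyγ₁, applyγ₂, lift_tmul, AddMonoidHom.finsetSum_apply,
    AddMonoidHom.comp_apply, AddMonoidHom.flip_apply, AddMonoidHom.compHom_apply_apply,
    AddMonoidHom.compr₂_apply, AddMonoidHom.eval_apply_apply] at left right
  simp only [hγ₁, hγ₂, tmulRight_sum_tmul, tmulLeft_sum_tmul]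
  refine left.trans (Eq.trans ?_ right.symm)
  rw [Finset.sum_comm]
  simp only [conv_assoc, T]

end Bal

end BalancedMaps

/-- A ring `A` with a second associative product `conv` and unit `i` for it, maps `s : L → A` and
`u : R → A` from two base rings identified in two ways `μ`, `ν` up to reversal of products, a left
counit `π`, and a bijection `S` reversing both products. For a Frobenius 1-morphism, `s` and `u` are
the whiskerings `l ↦ l × ῑ` and `r ↦ ι × r`. -/
structure DoubleAlgebra (A L R : Type*) [Ring A] [Ring L] [Ring R] where
  conv : A →+ A →+ A
  i : A
  s : L →+* A
  u : R →+* A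
  (μ ν : L ≃+* Rᵐᵒᵖ)
  S : A ≃+ A
  π : A →+ L
  conv_assoc : ∀ x y z, conv (conv x y) z = conv x (conv y z)
  conv_i : ∀ x, conv x i = x
  s_u_comm : ∀ l r, s l * u r = u r * s l
  s_mul_conv : ∀ l x y, s l * conv x y = conv (s l * x) y
  conv_mul_s : ∀ l x y, conv x y * s l = conv (x * s l) y
  conv_s_mul : ∀ l x y, conv x (s l * y) = conv (u (unop (μ l)) * x) y
  s_injective : Function.Injective s
  s_π : ∀ x, s (π x) = conv (x * i) 1
  s_π_mul_i : ∀ x, s (π x) * i = x * i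
  S_mul : ∀ x y, S (x * y) = S y * S x
  S_conv : ∀ x y, S (conv x y) = conv (S y) (S x)
  S_u : ∀ l, S (u (unop (μ l))) = s l
  S_s : ∀ l, S (s l) = u (unop (ν l))

namespace DoubleAlgebra

variable {A L R : Type*} [Ring A] [Ring L] [Ring R] (D : DoubleAlgebra A L R)

theorem S_symm_mul (x y : A) : D.S.symm (x * y) = D.S.symm y * D.S.symm x := by
  simp [AddEquiv.symm_apply_eq, D.S_mul]

theorem S_symm_conv (x y : A) : D.S.symm (D.conv x y) = D.conv (D.S.symm y) (D.S.symm x) := by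
  simp [AddEquiv.symm_apply_eq, D.S_conv]

theorem S_one : D.S 1 = 1 := by
  simpa using (D.S_mul (D.S.symm 1) 1).symm

theorem S_i : D.S D.i = D.i := by
  simpa [D.conv_i] using (D.S_conv (D.S.symm D.i) D.i).symm

theorem i_conv (x : A) : D.conv D.i x = x := by
  simpa [D.conv_i, D.S_i] using (D.S_conv (D.S.symm x) D.i).symm

theorem S_s_symm (r : R) : D.S (D.s (D.ν.symm (op r))) = D.u r := by
  rw [D.S_s, RingEquiv.apply_symm_apply, unop_op]

theorem u_injective : Function.Injective D.u := fun r r' h => by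
  rw [← D.S_s_symm, ← D.S_s_symm] at h
  exact op_injective (D.ν.symm.injective (D.s_injective (D.S.injective h)))

theorem u_mul_conv (r : R) (x y : A) : D.u r * D.conv x y = D.conv x (D.u r * y) := by
  obtain ⟨x, rfl⟩ := D.S.surjective x
  obtain ⟨y, rfl⟩ := D.S.surjective y
  rw [← D.S_s_symm, ← D.S_conv, ← D.S_mul, D.conv_mul_s, D.S_conv, D.S_mul]

theorem conv_mul_u (r : R) (x y : A) : D.conv x y * D.u r = D.conv x (y * D.u r) := by
  obtain ⟨x, rfl⟩ := D.S.surjective x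
  obtain ⟨y, rfl⟩ := D.S.surjective y
  rw [← D.S_s_symm, ← D.S_conv, ← D.S_mul, D.s_mul_conv, D.S_conv, D.S_mul]

theorem conv_mul_s' (l : L) (x y : A) :
    D.conv x (y * D.s l) = D.conv (x * D.u (unop (D.ν l))) y := by
  obtain ⟨x, rfl⟩ := D.S.surjective x
  obtain ⟨y, rfl⟩ := D.S.surjective y
  rw [← D.S_u, ← D.S_mul, ← D.S_conv, ← D.conv_s_mul, D.S_conv, D.S_mul, D.S_s]

theorem u_μ_mul_i (l : L) : D.u (unop (D.μ l)) * D.i = D.s l * D.i := by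
  rw [← D.conv_i (D.u _ * D.i), ← D.conv_s_mul, D.i_conv]

theorem i_mul_u_ν (l : L) : D.i * D.u (unop (D.ν l)) = D.i * D.s l := by
  rw [← D.conv_i (D.i * D.u _), ← D.conv_mul_s', D.i_conv]

/-- The right counit. -/
def πR : A →+ R :=
  AddMonoidHom.mk' (fun x => unop (D.ν (D.π (D.S.symm x)))) fun x y => by simp

theorem u_πR (x : A) : D.u (D.πR x) = D.conv 1 (D.i * x) := by
  change D.u (unop (D.ν (D.π (D.S.symm x)))) = _
  rw [← D.S_s, D.s_π, D.S_conv, D.S_mul, D.S_i, D.S_one, AddEquiv.apply_symm_apply]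

theorem i_mul_u_πR (x : A) : D.i * D.u (D.πR x) = D.i * x := by
  simpa [πR, D.S_mul, D.S_i, D.S_s] using congrArg D.S (D.s_π_mul_i (D.S.symm x))

/-- The target map of the left bialgebroid. -/
def tL : Lᵐᵒᵖ →+* A where
  toFun l := D.u (unop (D.μ (unop l)))
  map_one' := by simp
  map_mul' l m := by simp
  map_zero' := by simp
  map_add' l m := by simp

/-- The target map of the right bialgebroid. -/
def tR : Rᵐᵒᵖ →+* A := D.s.comp D.ν.symm.toRingHom

theorem tL_op (l : L) : D.tL (op l) = D.u (unop (D.μ l)) := rfl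

theorem tR_apply (r : Rᵐᵒᵖ) : D.tR r = D.s (D.ν.symm r) := rfl

theorem conv_mul_tR (r : R) (x y : A) : D.conv x (y * D.tR (op r)) = D.conv (x * D.u r) y := by
  rw [tR_apply, D.conv_mul_s', RingEquiv.apply_symm_apply, unop_op]

theorem i_mul_tR (r : R) : D.i * D.tR (op r) = D.i * D.u r := by
  rw [tR_apply, ← D.i_mul_u_ν, RingEquiv.apply_symm_apply, unop_op]

theorem conv_mul_i (a c : A) : D.conv a (c * D.i) = D.tL (op (D.π c)) * a := by
  rw [← D.s_π_mul_i, D.conv_s_mul, D.conv_i, tL_op]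

theorem mul_i_conv (a c : A) : D.conv (c * D.i) a = D.s (D.π c) * a := by
  rw [← D.s_π_mul_i, ← D.s_mul_conv, D.i_conv]

theorem conv_i_mul (a c : A) : D.conv a (D.i * c) = a * D.u (D.πR c) := by
  rw [← D.i_mul_u_πR, ← D.conv_mul_u, D.conv_i]

theorem i_mul_conv (a c : A) : D.conv (D.i * c) a = a * D.tR (op (D.πR c)) := by
  rw [← D.i_mul_u_πR, ← D.i_mul_tR, tR_apply, ← D.conv_mul_s, D.i_conv]

theorem π_s_mul (l : L) (a : A) : D.π (D.s l * a) = l * D.π a :=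
  D.s_injective <| by rw [map_mul D.s, D.s_π, D.s_π, mul_assoc, D.s_mul_conv]

theorem π_tL_mul (l : L) (a : A) : D.π (D.tL (op l) * a) = D.π a * l :=
  D.s_injective <| by
    rw [map_mul D.s, D.s_π, D.s_π, D.conv_mul_s, mul_assoc a, ← D.i_mul_u_ν, ← mul_assoc a,
      ← D.conv_mul_s', D.tL_op, mul_assoc, ← D.conv_s_mul, one_mul, mul_one]

theorem πR_mul_u (r : R) (a : A) : D.πR (a * D.u r) = D.πR a * r :=
  D.u_injective <| by rw [map_mul D.u, D.u_πR, D.u_πR, ← mul_assoc, D.conv_mul_u]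

theorem πR_mul_tR (r : R) (a : A) : D.πR (a * D.tR (op r)) = r * D.πR a :=
  D.u_injective <| by
    obtain ⟨l, hl⟩ : ∃ l, unop (D.μ l) = r := ⟨D.μ.symm (op r), by simp⟩
    rw [map_mul D.u, D.u_πR, D.u_πR, ← mul_assoc, D.conv_mul_tR, one_mul, D.u_mul_conv, ← hl,
      ← mul_assoc, D.u_μ_mul_i, mul_assoc, D.conv_s_mul, mul_one]

theorem conv_actAL (l : L) (x y : A) : D.conv x (actAL D.tL l y) = actAL D.tL l (D.conv x y) :=
  (D.u_mul_conv _ x y).symm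

theorem actLA_conv (l : L) (x y : A) : D.conv (actLA D.s l x) y = actLA D.s l (D.conv x y) :=
  (D.s_mul_conv _ x y).symm

theorem conv_actAR (r : R) (x y : A) : D.conv x (actAR D.u r y) = actAR D.u r (D.conv x y) :=
  (D.conv_mul_u _ x y).symm

theorem actRA_conv (r : R) (x y : A) : D.conv (actRA D.tR r x) y = actRA D.tR r (D.conv x y) :=
  (D.conv_mul_s _ x y).symm

/-- The map `a ⊗ b ↦ (a x) * (b y)`, where `*` is `conv`. -/
def evalL (x y : A) : Bal (actAL D.tL) (actLA D.s) →+ A :=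
  Bal.lift ((D.conv.compl₂ (AddMonoidHom.mulRight y)).comp (AddMonoidHom.mulRight x))
    fun l a b => by
      simp [actAL, actLA, mul_assoc, D.conv_s_mul, tL_op]

/-- The map `a ⊗ b ↦ (x a) * (y b)`, where `*` is `conv`. -/
def evalR (x y : A) : Bal (actAR D.u) (actRA D.tR) →+ A :=
  Bal.lift ((D.conv.compl₂ (AddMonoidHom.mulLeft y)).comp (AddMonoidHom.mulLeft x))
    fun r a b => by
      simp [actAR, actRA, ← mul_assoc, D.conv_mul_tR]

theorem evalL_tmul (x y a b : A) : D.evalL x y (Bal.tmul a b) = D.conv (a * x) (b * y) := rfl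

theorem evalR_tmul (x y a b : A) : D.evalR x y (Bal.tmul a b) = D.conv (x * a) (y * b) := rfl

theorem range_s : D.s.range = D.tR.range := by
  ext x
  simp only [RingHom.mem_range]
  exact ⟨fun ⟨l, hl⟩ => ⟨D.ν l, by simpa [D.tR_apply] using hl⟩, fun ⟨r, hr⟩ => ⟨D.ν.symm r, hr⟩⟩

theorem range_tL : D.tL.range = D.u.range := by
  ext x
  simp only [RingHom.mem_range]
  exact ⟨fun ⟨l, hl⟩ => ⟨unop (D.μ (unop l)), hl⟩,
    fun ⟨r, hr⟩ => ⟨op (D.μ.symm (op r)), by simpa [D.tL_op] using hr⟩⟩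

theorem S_tL (l : L) : D.S (D.tL (op l)) = D.s l := D.S_u l

theorem S_tR (r : R) : D.S (D.tR (op r)) = D.u r := D.S_s_symm r

/-- The map `a ⊗ b ↦ S(a) b`. -/
def antipodeMul : Bal (actAL D.tL) (actLA D.s) →+ A :=
  Bal.lift (AddMonoidHom.mul.comp D.S.toAddMonoidHom) fun l x y => by
    simp [actAL, actLA, D.S_mul, D.S_tL, mul_assoc]

/-- The map `a ⊗ b ↦ a S(b)`. -/
def mulAntipode : Bal (actAR D.u) (actRA D.tR) →+ A :=
  Bal.lift (AddMonoidHom.mul.compl₂ D.S.toAddMonoidHom) fun r x y => by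
    simp [actAR, actRA, D.S_mul, D.S_tR, mul_assoc]

variable {κ : Type*} [Fintype κ] (p q : κ → A)

/-- `∑ₖ p k ⊗ q k` is a Casimir element for `conv` over `L` implementing the interchange of the two
products: multiplying by it from the left makes `conv a c` act on `conv x y` factorwise. -/
def IsLeftCasimir : Prop :=
  ∀ a c x y, ∑ k, D.conv (D.conv a (p k) * x) (D.conv (q k) c * y) = D.conv a c * D.conv x y

/-- The mirror image of `IsLeftCasimir`, for products from the right. -/
def IsRightCasimir : Prop :=
  ∀ a c x y, ∑ k, D.conv (x * D.conv a (p k)) (y * D.conv (q k) c) = D.conv x y * D.conv a c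

/-- The left coproduct `a ↦ ∑ₖ (a * p k) ⊗ q k`, where `*` is `conv`. -/
def coproductL : A →+ Bal (actAL D.tL) (actLA D.s) :=
  ∑ k, ((Bal.tmulHom _ _).flip (q k)).comp (D.conv.flip (p k))

/-- The right coproduct `a ↦ ∑ₖ (a * p k) ⊗ q k`, where `*` is `conv`. -/
def coproductR : A →+ Bal (actAR D.u) (actRA D.tR) :=
  ∑ k, ((Bal.tmulHom _ _).flip (q k)).comp (D.conv.flip (p k))

theorem coproductL_apply (a : A) : D.coproductL p q a = ∑ k, Bal.tmul (D.conv a (p k)) (q k) := by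
  simp [coproductL]

theorem coproductR_apply (a : A) : D.coproductR p q a = ∑ k, Bal.tmul (D.conv a (p k)) (q k) := by
  simp [coproductR]

variable {D p q}

theorem IsLeftCasimir.isRightCasimir_map (h : D.IsLeftCasimir p q) (T : A ≃+ A)
    (T_mul : ∀ x y, T (x * y) = T y * T x) (T_conv : ∀ x y, T (D.conv x y) = D.conv (T y) (T x)) :
    D.IsRightCasimir (T ∘ q) (T ∘ p) := fun a c x y => by
  obtain ⟨a, rfl⟩ := T.surjective a
  obtain ⟨c, rfl⟩ := T.surjective c
  obtain ⟨x, rfl⟩ := T.surjective x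
  obtain ⟨y, rfl⟩ := T.surjective y
  simpa only [map_sum, T_mul, T_conv, Function.comp_apply] using congrArg T (h c a y x)

theorem IsRightCasimir.isLeftCasimir_S_symm (h : D.IsRightCasimir p q) :
    D.IsLeftCasimir (D.S.symm ∘ q) (D.S.symm ∘ p) := fun a c x y => by
  obtain ⟨a, rfl⟩ := D.S.symm.surjective a
  obtain ⟨c, rfl⟩ := D.S.symm.surjective c
  obtain ⟨x, rfl⟩ := D.S.symm.surjective x
  obtain ⟨y, rfl⟩ := D.S.symm.surjective y
  simpa only [map_sum, D.S_symm_mul, D.S_symm_conv, Function.comp_apply]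
    using congrArg D.S.symm (h c a y x)

theorem IsLeftCasimir.isRightCasimir_S (h : D.IsLeftCasimir p q) :
    D.IsRightCasimir (D.S ∘ q) (D.S ∘ p) :=
  h.isRightCasimir_map D.S D.S_mul D.S_conv

theorem IsLeftCasimir.isRightCasimir_S_symm (h : D.IsLeftCasimir p q) :
    D.IsRightCasimir (D.S.symm ∘ q) (D.S.symm ∘ p) :=
  h.isRightCasimir_map D.S.symm D.S_symm_mul D.S_symm_conv

namespace IsLeftCasimir

variable (h : D.IsLeftCasimir p q)
include h

theorem evalL_coproductL (x y a : A) :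
    D.evalL x y (D.coproductL p q a) = a * D.conv x y := by
  simpa [coproductL_apply, evalL_tmul, D.i_conv, D.conv_i] using h a D.i x y

theorem sum_s_π_mul (b : A) : ∑ k, D.s (D.π (D.conv b (p k))) * q k = b := by
  simpa [D.i_conv, D.conv_i, D.mul_i_conv] using h b D.i D.i 1

theorem evalL_ext {z z' : Bal (actAL D.tL) (actLA D.s)}
    (hz : ∀ y, D.evalL 1 y z = D.evalL 1 y z') : z = z' := by
  let c (k : κ) : Bal (actAL D.tL) (actLA D.s) →+ A :=
    ∑ j, (D.conv.flip (p k * D.S (p j))).comp (D.evalL 1 (D.S (q j)))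
  have c_apply (z k) :
      c k z = ∑ j, D.conv (D.evalL 1 (D.S (q j)) z) (p k * D.S (p j)) := by simp [c]
  refine Bal.ext_of_dual_basis (r := fun k b => D.π (D.conv b (p k))) h.sum_s_π_mul c
    (fun k a b => ?_) fun k => by simp only [c_apply, hz]
  have casimir := h.isRightCasimir_S D.i D.i b (p k)
  simp only [Function.comp_apply, D.i_conv, D.conv_i] at casimir
  simp only [c_apply, D.evalL_tmul, mul_one, D.conv_assoc]
  rw [← map_sum, casimir, D.conv_mul_i, actAL]

theorem coproductL_apply' (a : A) :
    D.coproductL p q a = ∑ k, Bal.tmul (p k) (D.conv (q k) a) := by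
  refine h.evalL_ext fun y => ?_
  rw [h.evalL_coproductL, map_sum]
  simpa [D.i_conv, D.evalL_tmul] using (h D.i a 1 y).symm

end IsLeftCasimir

namespace IsRightCasimir

variable (h : D.IsRightCasimir p q)
include h

theorem evalR_coproductR (x y a : A) :
    D.evalR x y (D.coproductR p q a) = D.conv x y * a := by
  simpa [coproductR_apply, evalR_tmul, D.i_conv, D.conv_i] using h a D.i x y

theorem sum_mul_tR (b : A) : ∑ k, q k * D.tR (op (D.πR (D.conv b (p k)))) = b := by
  simpa [D.i_conv, D.conv_i, D.i_mul_conv] using h b D.i D.i 1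

theorem evalR_ext {z z' : Bal (actAR D.u) (actRA D.tR)}
    (hz : ∀ y, D.evalR 1 y z = D.evalR 1 y z') : z = z' := by
  let c (k : κ) : Bal (actAR D.u) (actRA D.tR) →+ A :=
    ∑ j, (D.conv.flip (D.S.symm (p j) * p k)).comp (D.evalR 1 (D.S.symm (q j)))
  have c_apply (z k) :
      c k z = ∑ j, D.conv (D.evalR 1 (D.S.symm (q j)) z) (D.S.symm (p j) * p k) := by simp [c]
  refine Bal.ext_of_dual_basis (r := fun k b => D.πR (D.conv b (p k))) h.sum_mul_tR c
    (fun k a b => ?_) fun k => by simp only [c_apply, hz]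
  have casimir := h.isLeftCasimir_S_symm D.i D.i b (p k)
  simp only [Function.comp_apply, D.i_conv, D.conv_i] at casimir
  simp only [c_apply, D.evalR_tmul, one_mul, D.conv_assoc]
  rw [← map_sum, casimir, D.conv_i_mul, actAR]

theorem coproductR_apply' (a : A) :
    D.coproductR p q a = ∑ k, Bal.tmul (p k) (D.conv (q k) a) := by
  refine h.evalR_ext fun y => ?_
  rw [h.evalR_coproductR, map_sum]
  simpa [D.i_conv, D.evalR_tmul] using (h D.i a 1 y).symm

theorem coproductR_unique {κ' : Type*} [Fintype κ'] {p' q' : κ' → A}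
    (h' : D.IsRightCasimir p' q') : D.coproductR p q = D.coproductR p' q' :=
  AddMonoidHom.ext fun a => h.evalR_ext fun y => by
    rw [h.evalR_coproductR, h'.evalR_coproductR]

end IsRightCasimir

namespace IsLeftCasimir

variable (h : D.IsLeftCasimir p q)
include h

theorem sum_conv_of_coproductL_eq {a : A} {n : ℕ} {p' q' : Fin n → A}
    (ha : D.coproductL p q a = ∑ k, Bal.tmul (p' k) (q' k)) (x y : A) :
    ∑ k, D.conv (p' k * x) (q' k * y) = a * D.conv x y := by
  rw [← h.evalL_coproductL, ha, map_sum]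
  rfl

/-- The left bialgebroid of a double algebra with a Casimir element. -/
def leftBialgebroid : LeftBialgebroid A L where
  s := D.s
  t := D.tL
  γ := D.coproductL p q
  π := D.π
  comm l l' := D.s_u_comm _ _
  γ_left l a m p q ha := by
    refine h.evalL_ext fun y => ?_
    simp only [h.evalL_coproductL, map_sum, D.evalL_tmul, mul_assoc, ← D.s_mul_conv]
    rw [← Finset.mul_sum, h.sum_conv_of_coproductL_eq ha]
  γ_right l a m p q ha := by
    refine h.evalL_ext fun y => ?_
    simp only [h.evalL_coproductL, map_sum, D.evalL_tmul, mul_assoc, D.tL_op, ← D.u_mul_conv]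
    rw [← Finset.mul_sum, h.sum_conv_of_coproductL_eq ha]
  π_left := D.π_s_mul
  π_right := D.π_tL_mul
  coassoc a m p q ha := Bal.mixed_coassoc D.conv D.conv_assoc D.conv_actAL D.actLA_conv
    h.coproductL_apply' (D.coproductL_apply _ _) a ha ha
  counit_left a m p q ha := by
    simpa [D.mul_i_conv, D.i_conv] using h.sum_conv_of_coproductL_eq ha D.i 1
  counit_right a m p q ha := by
    simpa [D.conv_mul_i, D.conv_i] using h.sum_conv_of_coproductL_eq ha 1 D.i
  γ_cross l a m p q ha := by
    refine h.evalL_ext fun y => ?_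
    simp only [map_sum, D.evalL_tmul, mul_assoc, h.sum_conv_of_coproductL_eq ha, D.conv_s_mul,
      D.tL_op]
  γ_one := by
    refine h.evalL_ext fun y => ?_
    simp only [h.evalL_coproductL, D.evalL_tmul, one_mul]
  γ_mul a b m p q m' p' q' ha hb := by
    refine h.evalL_ext fun y => ?_
    simp only [h.evalL_coproductL, map_sum, D.evalL_tmul, mul_assoc]
    rw [Finset.sum_comm]
    simp only [h.sum_conv_of_coproductL_eq ha]
    rw [← Finset.mul_sum, h.sum_conv_of_coproductL_eq hb]
  π_one := D.s_injective (by rw [D.s_π, one_mul, D.i_conv, map_one])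
  π_mul_s a b := D.s_injective (by
    rw [D.s_π (a * _), D.s_π (a * b), mul_assoc, D.s_π_mul_i, mul_assoc])
  π_mul_t a b := D.s_injective (by
    rw [D.s_π, D.s_π, mul_assoc, D.tL_op, D.u_μ_mul_i, D.s_π_mul_i, mul_assoc])

end IsLeftCasimir

namespace IsRightCasimir

variable (h : D.IsRightCasimir p q)
include h

theorem sum_conv_of_coproductR_eq {a : A} {n : ℕ} {p' q' : Fin n → A}
    (ha : D.coproductR p q a = ∑ k, Bal.tmul (p' k) (q' k)) (x y : A) :
    ∑ k, D.conv (x * p' k) (y * q' k) = D.conv x y * a := by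
  rw [← h.evalR_coproductR, ha, map_sum]
  rfl

/-- The right bialgebroid of a double algebra with a Casimir element. -/
def rightBialgebroid : RightBialgebroid A R where
  s := D.u
  t := D.tR
  γ := D.coproductR p q
  π := D.πR
  comm r r' := (D.s_u_comm _ _).symm
  γ_left r a m p q ha := by
    refine h.evalR_ext fun y => ?_
    simp only [h.evalR_coproductR, map_sum, D.evalR_tmul, ← mul_assoc, D.tR_apply, ← D.conv_mul_s]
    rw [← Finset.sum_mul, h.sum_conv_of_coproductR_eq ha]
  γ_right r a m p q ha := by
    refine h.evalR_ext fun y => ?_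
    simp only [h.evalR_coproductR, map_sum, D.evalR_tmul, ← mul_assoc, ← D.conv_mul_u]
    rw [← Finset.sum_mul, h.sum_conv_of_coproductR_eq ha]
  π_left := D.πR_mul_tR
  π_right := D.πR_mul_u
  coassoc a m p q ha := Bal.mixed_coassoc D.conv D.conv_assoc D.conv_actAR D.actRA_conv
    h.coproductR_apply' (D.coproductR_apply _ _) a ha ha
  counit_left a m p q ha := by
    simpa [D.i_mul_conv, D.i_conv] using h.sum_conv_of_coproductR_eq ha D.i 1
  counit_right a m p q ha := by
    simpa [D.conv_i_mul, D.conv_i] using h.sum_conv_of_coproductR_eq ha 1 D.i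
  γ_cross r a m p q ha := by
    refine h.evalR_ext fun y => ?_
    simp only [map_sum, D.evalR_tmul, ← mul_assoc, h.sum_conv_of_coproductR_eq ha, D.conv_mul_tR]
  γ_one := by
    refine h.evalR_ext fun y => ?_
    simp only [h.evalR_coproductR, D.evalR_tmul, mul_one]
  γ_mul a b m p q m' p' q' ha hb := by
    refine h.evalR_ext fun y => ?_
    simp only [h.evalR_coproductR, map_sum, D.evalR_tmul, ← mul_assoc,
      h.sum_conv_of_coproductR_eq hb]
    rw [← Finset.sum_mul, h.sum_conv_of_coproductR_eq ha]
  π_one := D.u_injective (by rw [D.u_πR, mul_one, D.conv_i, map_one])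
  π_s_mul a b := D.u_injective (by
    rw [D.u_πR (_ * b), D.u_πR (a * b), ← mul_assoc, D.i_mul_u_πR, ← mul_assoc])
  π_t_mul a b := D.u_injective (by
    rw [D.u_πR, D.u_πR, ← mul_assoc, D.i_mul_tR, D.i_mul_u_πR, ← mul_assoc])

end IsRightCasimir

theorem IsLeftCasimir.sum_S_mul (h : D.IsLeftCasimir p q)
    (antipode : ∀ c, ∑ k, D.S (p k) * D.conv (q k) c = D.conv 1 (D.i * c))
    {a : A} {n : ℕ} {p' q' : Fin n → A} (ha : D.coproductL p q a = ∑ k, Bal.tmul (p' k) (q' k)) :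
    ∑ k, D.S (p' k) * q' k = D.u (D.πR a) := by
  have key := congrArg (D.antipodeMul) (ha.symm.trans (h.coproductL_apply' a))
  simp only [map_sum] at key
  rw [D.u_πR, ← antipode]
  exact key

theorem IsRightCasimir.sum_mul_S (hL : D.IsLeftCasimir p q) {κ' : Type*} [Fintype κ']
    {r r' : κ' → A} (hR : D.IsRightCasimir r r')
    (antipode : ∀ c, ∑ k, D.S (p k) * D.conv (q k) c = D.conv 1 (D.i * c))
    {a : A} {n : ℕ} {p' q' : Fin n → A} (ha : D.coproductR r r' a = ∑ k, Bal.tmul (p' k) (q' k)) :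
    ∑ k, p' k * D.S (q' k) = D.s (D.π a) := by
  have key := congrArg (D.mulAntipode)
    (ha.symm.trans ((DFunLike.congr_fun (hR.coproductR_unique hL.isRightCasimir_S) a).trans
      (D.coproductR_apply _ _ a)))
  have S_antipode := congrArg D.S (antipode (D.S.symm a))
  simp only [map_sum, D.S_mul, D.S_conv, D.S_i, D.S_one, AddEquiv.apply_symm_apply]
    at key S_antipode
  rw [D.s_π, ← S_antipode]
  exact key

/-- The Hopf algebroid of a double algebra with Casimir elements. -/
def IsLeftCasimir.hopfAlgebroid {κ' : Type*} [Fintype κ'] {r r' : κ' → A}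
    (hL : D.IsLeftCasimir p q) (hR : D.IsRightCasimir r r')
    (antipode : ∀ c, ∑ k, D.S (p k) * D.conv (q k) c = D.conv 1 (D.i * c)) :
    HopfAlgebroid A L R where
  left := hL.leftBialgebroid
  right := hR.rightBialgebroid
  S := D.S
  base := ⟨(RingEquiv.opOp R).trans D.ν.op.symm⟩
  range_s_left := D.range_s
  range_t_left := D.range_tL
  coassoc_left_right a m p q m' p' q' haR haL := Bal.mixed_coassoc D.conv D.conv_assoc D.conv_actAR
    D.actLA_conv hL.coproductL_apply' (D.coproductR_apply _ _) a haR haL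
  coassoc_right_left a m p q m' p' q' haL haR := Bal.mixed_coassoc D.conv D.conv_assoc D.conv_actAL
    D.actRA_conv hR.coproductR_apply' (D.coproductL_apply _ _) a haL haR
  S_left l l' a := by
    change D.S (D.tL (op l) * a * D.tL (op l')) = D.s l' * D.S a * D.s l
    rw [D.S_mul, D.S_mul, D.S_tL, D.S_tL, mul_assoc]
  S_right r r' a := by
    change D.S (D.tR (op r') * a * D.tR (op r)) = D.u r * D.S a * D.u r'
    rw [D.S_mul, D.S_mul, D.S_tR, D.S_tR, mul_assoc]
  antipode_left a m p q ha := hL.sum_S_mul antipode ha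
  antipode_right a m p q ha := hR.sum_mul_S hL antipode ha

end DoubleAlgebra

theorem PreadditiveBicategory.sum_whiskerRight {C : Type u} [Bicategory.{w, v} C]
    [PreadditiveBicategory C] {a b c : C} {f g : a ⟶ b} (h : b ⟶ c) {κ : Type*} [Fintype κ]
    (θ : κ → (f ⟶ g)) : (∑ k, θ k) ▷ h = ∑ k, θ k ▷ h :=
  map_sum (AddMonoidHom.mk' (fun θ : f ⟶ g => θ ▷ h) fun θ θ' => add_whiskerRight θ θ' h) θ
    Finset.univ

namespace TwoSidedDual

open Bicategory

section FourierTransform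

variable {C : Type u} [Bicategory.{w, v} C] {a b : C} {ι : a ⟶ b} {ῑ : b ⟶ a}
  (D : TwoSidedDual ι ῑ)

/-- Exchanging the roles of `ι` and `ῑ`, hence of `A` and `B` and of `L` and `R`. -/
def swap : TwoSidedDual ῑ ι := ⟨D.right, D.left⟩

theorem convB_eq_swap_convA (x y : ῑ ≫ ι ⟶ ῑ ≫ ι) : D.convB x y = D.swap.convA x y := by
  dsimp only [convA, convB, swap, evL, evR, coevL, coevR]
  bicategory

theorem fourierDot_eq_mateEquiv (x : ι ≫ ῑ ⟶ ι ≫ ῑ) :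
    D.fourierDot x = mateEquiv D.left D.right x := by
  rw [mateEquiv_apply']
  dsimp only [fourierDot, evL, coevR]
  bicategory

theorem swap_fourier_eq_mateEquiv_symm (x : ῑ ≫ ι ⟶ ῑ ≫ ι) :
    D.swap.fourier x = (mateEquiv D.left D.right).symm x := by
  rw [mateEquiv_symm_apply']
  dsimp only [fourier, evL, coevR, swap]
  bicategory

theorem mu_eq_conjugateEquiv (l : ι ⟶ ι) : D.mu l = conjugateEquiv D.left D.left l := by
  rw [conjugateEquiv_apply']
  dsimp only [mu, evL, coevL]
  bicategory

theorem nu_eq_conjugateEquiv_symm (l : ι ⟶ ι) :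
    D.nu l = (conjugateEquiv D.right D.right).symm l :=
  (conjugateEquiv_symm_apply' D.right D.right l).symm

theorem swap_fourier_fourierDot (x : End (ι ≫ ῑ)) : D.swap.fourier (D.fourierDot x) = x := by
  rw [fourierDot_eq_mateEquiv, swap_fourier_eq_mateEquiv_symm, Equiv.symm_apply_apply]

theorem fourierDot_swap_fourier (x : End (ῑ ≫ ι)) : D.fourierDot (D.swap.fourier x) = x := by
  rw [fourierDot_eq_mateEquiv, swap_fourier_eq_mateEquiv_symm, Equiv.apply_symm_apply]

theorem fourierDot_convA (x y : ι ≫ ῑ ⟶ ι ≫ ῑ) :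
    D.fourierDot (D.convA x y) = D.fourierDot x ≫ D.fourierDot y := by
  dsimp only [fourierDot, convA]
  symm
  calc
    _ = 𝟙 _ ⊗≫ ῑ ◁ (ι ◁ D.coevR ⊗≫ x ▷ ι) ⊗≫ (D.evL ▷ (ῑ ≫ ι) ≫ 𝟙 b ◁
          (𝟙 _ ⊗≫ (ῑ ≫ ι) ◁ D.coevR ⊗≫ ῑ ◁ y ▷ ι ⊗≫ D.evL ▷ (ῑ ≫ ι) ⊗≫ 𝟙 (ῑ ≫ ι))) ⊗≫ 𝟙 _ := by
      bicategory
    _ = 𝟙 _ ⊗≫ ῑ ◁ ((ι ◁ D.coevR ⊗≫ x ▷ ι) ▷ 𝟙 b ≫ ((ι ≫ ῑ) ≫ ι) ◁ D.coevR) ⊗≫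
          ῑ ◁ ι ◁ ῑ ◁ y ▷ ι ⊗≫ ῑ ◁ ι ◁ D.evL ▷ ῑ ▷ ι ⊗≫ D.evL ▷ (ῑ ≫ ι) ⊗≫ 𝟙 (ῑ ≫ ι) := by
      rw [← whisker_exchange]
      bicategory
    _ = _ := by
      rw [← whisker_exchange]
      bicategory

theorem fourier_convA (x y : ι ≫ ῑ ⟶ ι ≫ ῑ) :
    D.fourier (D.convA x y) = D.fourier y ≫ D.fourier x := by
  dsimp only [fourier, convA]
  symm
  calc
    _ = 𝟙 (ῑ ≫ ι) ⊗≫ D.coevR ▷ (ῑ ≫ ι) ⊗≫ ῑ ◁ y ▷ ι ⊗≫ ((ῑ ≫ ι) ◁ D.evL ≫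
          (𝟙 (ῑ ≫ ι) ⊗≫ D.coevR ▷ (ῑ ≫ ι) ⊗≫ ῑ ◁ x ▷ ι ⊗≫ (ῑ ≫ ι) ◁ D.evL ⊗≫
            𝟙 (ῑ ≫ ι)) ▷ 𝟙 b) ⊗≫ 𝟙 (ῑ ≫ ι) := by
      bicategory
    _ = 𝟙 (ῑ ≫ ι) ⊗≫ D.coevR ▷ (ῑ ≫ ι) ⊗≫
          (ῑ ◁ y ≫ (𝟙 ῑ ⊗≫ D.coevR ▷ ῑ ⊗≫ ῑ ◁ x) ▷ (ι ≫ ῑ)) ▷ ι ⊗≫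
            ῑ ◁ ι ◁ D.evL ▷ ῑ ▷ ι ⊗≫ (ῑ ≫ ι) ◁ D.evL ⊗≫ 𝟙 (ῑ ≫ ι) := by
      rw [whisker_exchange]
      bicategory
    _ = 𝟙 (ῑ ≫ ι) ⊗≫ (𝟙 b ◁ D.coevR ≫ D.coevR ▷ (ῑ ≫ ι)) ▷ (ῑ ≫ ι) ⊗≫
          ῑ ◁ x ▷ ι ▷ ῑ ▷ ι ⊗≫ ῑ ◁ ι ◁ ῑ ◁ y ▷ ι ⊗≫
            ῑ ◁ ι ◁ D.evL ▷ ῑ ▷ ι ⊗≫ (ῑ ≫ ι) ◁ D.evL ⊗≫ 𝟙 (ῑ ≫ ι) := by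
      rw [whisker_exchange]
      bicategory
    _ = _ := by
      rw [whisker_exchange]
      bicategory

theorem fourier_iA : D.fourier D.iA = 𝟙 (ῑ ≫ ι) := by
  dsimp only [fourier, iA, evL, evR, coevL, coevR]
  calc
    _ = 𝟙 (ῑ ≫ ι) ⊗≫ leftZigzag D.right.unit D.right.counit ▷ ι ⊗≫
        ῑ ◁ leftZigzag D.left.unit D.left.counit ⊗≫ 𝟙 (ῑ ≫ ι) := by
      bicategory
    _ = 𝟙 _ := by
      rw [D.right.left_triangle, D.left.left_triangle]
      bicategory

theorem fourierDot_iA : D.fourierDot D.iA = 𝟙 (ῑ ≫ ι) := by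
  dsimp only [fourierDot, iA, evL, evR, coevL, coevR]
  calc
    _ = 𝟙 (ῑ ≫ ι) ⊗≫ ῑ ◁ rightZigzag D.right.unit D.right.counit ⊗≫
        rightZigzag D.left.unit D.left.counit ▷ ι ⊗≫ 𝟙 (ῑ ≫ ι) := by
      bicategory
    _ = 𝟙 _ := by
      rw [D.right.right_triangle, D.left.right_triangle]
      bicategory

theorem fourierDot_whiskerRight_comp (l : ι ⟶ ι) (x : ι ≫ ῑ ⟶ ι ≫ ῑ) :
    D.fourierDot (l ▷ ῑ ≫ x) = ῑ ◁ l ≫ D.fourierDot x := by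
  dsimp only [fourierDot]
  calc
    _ = 𝟙 (ῑ ≫ ι) ⊗≫ ῑ ◁ (ι ◁ D.coevR ≫ l ▷ (ῑ ≫ ι)) ⊗≫ ῑ ◁ x ▷ ι ⊗≫ D.evL ▷ (ῑ ≫ ι) ⊗≫
        𝟙 (ῑ ≫ ι) := by bicategory
    _ = _ := by
      rw [whisker_exchange]
      bicategory

theorem fourierDot_comp_whiskerLeft (r : ῑ ⟶ ῑ) (x : ι ≫ ῑ ⟶ ι ≫ ῑ) :
    D.fourierDot (x ≫ ι ◁ r) = D.fourierDot x ≫ r ▷ ι := by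
  dsimp only [fourierDot]
  calc
    _ = 𝟙 (ῑ ≫ ι) ⊗≫ (ῑ ≫ ι) ◁ D.coevR ⊗≫ ῑ ◁ x ▷ ι ⊗≫ ((ῑ ≫ ι) ◁ r ≫ D.evL ▷ ῑ) ▷ ι ⊗≫
        𝟙 (ῑ ≫ ι) := by bicategory
    _ = _ := by
      rw [whisker_exchange]
      bicategory

theorem whiskerLeft_comp_evL (l : ι ⟶ ι) : ῑ ◁ l ≫ D.evL = D.mu l ▷ ι ≫ D.evL := by
  dsimp only [mu]
  symm
  calc
    _ = 𝟙 (ῑ ≫ ι) ⊗≫ ῑ ◁ D.coevL ▷ ι ⊗≫ ῑ ◁ l ▷ ῑ ▷ ι ⊗≫ (D.evL ▷ (ῑ ≫ ι) ≫ 𝟙 b ◁ D.evL) ⊗≫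
        𝟙 (𝟙 b) := by bicategory
    _ = 𝟙 (ῑ ≫ ι) ⊗≫ ῑ ◁ D.coevL ▷ ι ⊗≫ ῑ ◁ (l ▷ (ῑ ≫ ι) ≫ ι ◁ D.evL) ⊗≫ D.evL ⊗≫
        𝟙 (𝟙 b) := by
      rw [← whisker_exchange]
      bicategory
    _ = 𝟙 (ῑ ≫ ι) ⊗≫ ῑ ◁ leftZigzag D.left.unit D.left.counit ⊗≫ ῑ ◁ l ⊗≫ D.evL ⊗≫
        𝟙 (𝟙 b) := by
      rw [← whisker_exchange]
      dsimp only [evL, coevL]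
      bicategory
    _ = _ := by
      rw [D.left.left_triangle]
      bicategory

theorem coevR_comp_whiskerLeft (l : ι ⟶ ι) : D.coevR ≫ ῑ ◁ l = D.coevR ≫ D.nu l ▷ ι := by
  dsimp only [nu]
  symm
  calc
    _ = 𝟙 (𝟙 b) ⊗≫ (𝟙 b ◁ D.coevR ≫ D.coevR ▷ (ῑ ≫ ι)) ⊗≫ ῑ ◁ l ▷ ῑ ▷ ι ⊗≫ ῑ ◁ D.evR ▷ ι ⊗≫
        𝟙 (ῑ ≫ ι) := by bicategory
    _ = 𝟙 (𝟙 b) ⊗≫ D.coevR ⊗≫ ῑ ◁ (ι ◁ D.coevR ≫ l ▷ (ῑ ≫ ι)) ⊗≫ ῑ ◁ D.evR ▷ ι ⊗≫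
        𝟙 (ῑ ≫ ι) := by
      rw [whisker_exchange]
      bicategory
    _ = 𝟙 (𝟙 b) ⊗≫ D.coevR ⊗≫ ῑ ◁ l ⊗≫ ῑ ◁ rightZigzag D.right.unit D.right.counit ⊗≫
        𝟙 (ῑ ≫ ι) := by
      rw [whisker_exchange]
      dsimp only [evR, coevR]
      bicategory
    _ = _ := by
      rw [D.right.right_triangle]
      bicategory

theorem fourierDot_comp_whiskerRight (x : ι ≫ ῑ ⟶ ι ≫ ῑ) (l : ι ⟶ ι) :
    D.fourierDot (x ≫ l ▷ ῑ) = D.mu l ▷ ι ≫ D.fourierDot x := by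
  have slide := D.whiskerLeft_comp_evL l
  obtain ⟨r, hr⟩ : ∃ r : ῑ ⟶ ῑ, r = D.mu l := ⟨_, rfl⟩
  rw [← hr] at slide ⊢
  dsimp only [fourierDot]
  symm
  calc
    _ = 𝟙 (ῑ ≫ ι) ⊗≫ (r ▷ (ι ≫ 𝟙 b) ≫ ῑ ◁ (ι ◁ D.coevR ⊗≫ x ▷ ι)) ⊗≫ D.evL ▷ (ῑ ≫ ι) ⊗≫
        𝟙 (ῑ ≫ ι) := by bicategory
    _ = 𝟙 (ῑ ≫ ι) ⊗≫ ῑ ◁ (ι ◁ D.coevR ⊗≫ x ▷ ι) ⊗≫ (r ▷ ι ≫ D.evL) ▷ (ῑ ≫ ι) ⊗≫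
        𝟙 (ῑ ≫ ι) := by
      rw [← whisker_exchange]
      bicategory
    _ = _ := by
      rw [← slide]
      bicategory

theorem fourier_swap_fourierDot (x : End (ῑ ≫ ι)) : D.fourier (D.swap.fourierDot x) = x :=
  D.swap.swap_fourier_fourierDot x

theorem swap_fourierDot_fourier (x : End (ι ≫ ῑ)) : D.swap.fourierDot (D.fourier x) = x :=
  D.swap.fourierDot_swap_fourier x

theorem swap_iA : D.swap.iA = D.evL ≫ D.coevR := rfl

theorem fourier_one : D.fourier (𝟙 (ι ≫ ῑ)) = D.swap.iA := by
  rw [← D.swap.fourierDot_iA, fourier_swap_fourierDot]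

theorem fourierDot_one : D.fourierDot (𝟙 (ι ≫ ῑ)) = D.swap.iA := by
  rw [← D.swap.fourier_iA, fourierDot_swap_fourier]

theorem fourier_whiskerLeft_comp (r : ῑ ⟶ ῑ) (x : ι ≫ ῑ ⟶ ι ≫ ῑ) :
    D.fourier (ι ◁ r ≫ x) = r ▷ ι ≫ D.fourier x := by
  have key := D.swap.fourierDot_whiskerRight_comp r (D.fourier x)
  rw [swap_fourierDot_fourier] at key
  rw [← key, fourier_swap_fourierDot]

theorem fourier_comp_whiskerRight (x : ι ≫ ῑ ⟶ ι ≫ ῑ) (l : ι ⟶ ι) :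
    D.fourier (x ≫ l ▷ ῑ) = D.fourier x ≫ ῑ ◁ l := by
  have key := D.swap.fourierDot_comp_whiskerLeft l (D.fourier x)
  rw [swap_fourierDot_fourier] at key
  rw [← key, fourier_swap_fourierDot]

theorem fourier_whiskerLeft_mu (l : ι ⟶ ι) :
    D.fourier (ι ◁ D.mu l) = D.fourierDot (l ▷ ῑ) := by
  have hF := D.fourier_whiskerLeft_comp (D.mu l) (𝟙 (ι ≫ ῑ))
  have hFdot := D.fourierDot_whiskerRight_comp l (𝟙 (ι ≫ ῑ))
  rw [Category.comp_id, fourier_one] at hF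
  rw [Category.comp_id, fourierDot_one] at hFdot
  rw [hF, hFdot]
  simp only [swap_iA, ← Category.assoc, whiskerLeft_comp_evL]

theorem fourier_whiskerRight (l : ι ⟶ ι) :
    D.fourier (l ▷ ῑ) = D.fourierDot (ι ◁ D.nu l) := by
  have hF := D.fourier_comp_whiskerRight (𝟙 (ι ≫ ῑ)) l
  have hFdot := D.fourierDot_comp_whiskerLeft (D.nu l) (𝟙 (ι ≫ ῑ))
  rw [Category.id_comp, fourier_one, swap_iA, Category.assoc] at hF
  rw [Category.id_comp, fourierDot_one, swap_iA, Category.assoc] at hFdot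
  rw [hF, hFdot]
  rw [coevR_comp_whiskerLeft]

theorem fourier_comp (x y : ι ≫ ῑ ⟶ ι ≫ ῑ) :
    D.fourier (x ≫ y) = D.swap.convA (D.fourier x) (D.fourier y) := by
  obtain ⟨x, rfl⟩ : ∃ z, D.swap.fourierDot z = x := ⟨_, D.swap_fourierDot_fourier x⟩
  obtain ⟨y, rfl⟩ : ∃ z, D.swap.fourierDot z = y := ⟨_, D.swap_fourierDot_fourier y⟩
  rw [← fourierDot_convA]
  simp only [fourier_swap_fourierDot]

theorem fourierDot_comp (x y : ι ≫ ῑ ⟶ ι ≫ ῑ) :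
    D.fourierDot (x ≫ y) = D.swap.convA (D.fourierDot y) (D.fourierDot x) := by
  obtain ⟨x, rfl⟩ : ∃ z, D.swap.fourier z = x := ⟨_, D.swap_fourier_fourierDot x⟩
  obtain ⟨y, rfl⟩ : ∃ z, D.swap.fourier z = y := ⟨_, D.swap_fourier_fourierDot y⟩
  rw [← fourier_convA]
  simp only [fourierDot_swap_fourier]

theorem fourierDot_injective : Function.Injective D.fourierDot :=
  Function.LeftInverse.injective D.swap_fourier_fourierDot

theorem phiL_evR_comp (w : 𝟙 a ⟶ ι ≫ ῑ) :
    D.phiL (D.evR ≫ w) = 𝟙 ι ⊗≫ w ▷ ι ⊗≫ ι ◁ D.evL ⊗≫ 𝟙 ι := by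
  dsimp only [phiL]
  calc
    _ = 𝟙 ι ⊗≫ rightZigzag D.right.unit D.right.counit ⊗≫ w ▷ ι ⊗≫ ι ◁ D.evL ⊗≫ 𝟙 ι := by
      dsimp only [evR, coevR]
      bicategory
    _ = _ := by
      rw [D.right.right_triangle]
      bicategory

theorem iA_comp_phiL (x : ι ≫ ῑ ⟶ ι ≫ ῑ) : D.iA ≫ D.phiL (D.iA ≫ x) ▷ ῑ = D.iA ≫ x := by
  have phiL_eq : D.phiL (D.iA ≫ x) = 𝟙 ι ⊗≫ (D.coevL ≫ x) ▷ ι ⊗≫ ι ◁ D.evL ⊗≫ 𝟙 ι := by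
    rw [iA, Category.assoc, phiL_evR_comp]
  rw [phiL_eq, iA, Category.assoc, Category.assoc]
  congr 1
  calc
    _ = 𝟙 (𝟙 a) ⊗≫ (𝟙 a ◁ D.coevL ≫ (D.coevL ≫ x) ▷ (ι ≫ ῑ)) ⊗≫ ι ◁ D.evL ▷ ῑ ⊗≫ 𝟙 (ι ≫ ῑ) := by
      bicategory
    _ = 𝟙 (𝟙 a) ⊗≫ (D.coevL ≫ x) ⊗≫ ι ◁ rightZigzag D.left.unit D.left.counit ⊗≫ 𝟙 (ι ≫ ῑ) := by
      rw [whisker_exchange]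
      dsimp only [evL, coevL]
      bicategory
    _ = _ := by
      rw [D.left.right_triangle]
      bicategory

theorem convA_one (x : ι ≫ ῑ ⟶ ι ≫ ῑ) : D.convA x (𝟙 (ι ≫ ῑ)) = D.phiL x ▷ ῑ := by
  dsimp only [convA, phiL]
  bicategory

theorem convA_assoc (x y z : ι ≫ ῑ ⟶ ι ≫ ῑ) :
    D.convA (D.convA x y) z = D.convA x (D.convA y z) :=
  D.fourierDot_injective <| by simp only [fourierDot_convA, Category.assoc]

theorem convA_iA (x : ι ≫ ῑ ⟶ ι ≫ ῑ) : D.convA x D.iA = x :=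
  D.fourierDot_injective <| by rw [fourierDot_convA, fourierDot_iA, Category.comp_id]

theorem convA_comp_whiskerRight (l : ι ⟶ ι) (x y : ι ≫ ῑ ⟶ ι ≫ ῑ) :
    D.convA x y ≫ l ▷ ῑ = D.convA (x ≫ l ▷ ῑ) y :=
  D.fourierDot_injective <| by
    rw [fourierDot_comp_whiskerRight, fourierDot_convA, fourierDot_convA,
      fourierDot_comp_whiskerRight, Category.assoc]

theorem whiskerRight_comp_convA (l : ι ⟶ ι) (x y : ι ≫ ῑ ⟶ ι ≫ ῑ) :
    l ▷ ῑ ≫ D.convA x y = D.convA (l ▷ ῑ ≫ x) y :=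
  D.fourierDot_injective <| by
    rw [fourierDot_whiskerRight_comp, fourierDot_convA, fourierDot_convA,
      fourierDot_whiskerRight_comp, Category.assoc]

theorem convA_comp_whiskerRight_right (l : ι ⟶ ι) (x y : ι ≫ ῑ ⟶ ι ≫ ῑ) :
    D.convA x (y ≫ l ▷ ῑ) = D.convA (x ≫ ι ◁ D.mu l) y :=
  D.fourierDot_injective <| by
    rw [fourierDot_convA, fourierDot_convA, fourierDot_comp_whiskerRight,
      fourierDot_comp_whiskerLeft, Category.assoc]

theorem mu_comp (l l' : ι ⟶ ι) : D.mu (l ≫ l') = D.mu l' ≫ D.mu l := by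
  simp only [mu_eq_conjugateEquiv, Bicategory.conjugateEquiv_comp]

theorem nu_comp (l l' : ι ⟶ ι) : D.nu (l ≫ l') = D.nu l' ≫ D.nu l := by
  simp only [nu_eq_conjugateEquiv_symm, Bicategory.conjugateEquiv_symm_comp]

theorem swap_mu_nu (l : End ι) : D.swap.mu (D.nu l) = l := by
  rw [nu_eq_conjugateEquiv_symm, mu_eq_conjugateEquiv]
  exact Equiv.apply_symm_apply _ _

theorem nu_swap_mu (r : End ῑ) : D.nu (D.swap.mu r) = r := by
  rw [nu_eq_conjugateEquiv_symm, mu_eq_conjugateEquiv]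
  exact Equiv.symm_apply_apply _ _

theorem whiskerRight_injective (D : TwoSidedDual ι ῑ) :
    Function.Injective fun l : ι ⟶ ι => l ▷ ῑ := fun l l' h => by
  rw [← D.swap_mu_nu l, ← D.swap_mu_nu l', nu, nu, show l ▷ ῑ = l' ▷ ῑ from h]

theorem convA_comp_convA (a' c x y z w : ι ≫ ῑ ⟶ ι ≫ ῑ) :
    D.convA (c ≫ x) z ≫ D.convA (y ≫ a') w =
      𝟙 (ι ≫ ῑ) ⊗≫ ι ◁ D.coevR ▷ ῑ ⊗≫ (c ▷ (ι ≫ ῑ) ≫ (ι ≫ ῑ) ◁ z) ⊗≫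
        (x ▷ ι ≫ (α_ ι ῑ ι).hom ≫ ι ◁ D.evL ≫ ι ◁ D.coevR ≫ (α_ ι ῑ ι).inv ≫ y ▷ ι) ▷ ῑ ⊗≫
          (a' ▷ (ι ≫ ῑ) ≫ (ι ≫ ῑ) ◁ w) ⊗≫ ι ◁ D.evL ▷ ῑ ⊗≫ 𝟙 (ι ≫ ῑ) := by
  dsimp only [convA]
  calc
    _ = 𝟙 (ι ≫ ῑ) ⊗≫ ι ◁ D.coevR ▷ ῑ ⊗≫ c ▷ (ι ≫ ῑ) ⊗≫ (x ▷ (ι ≫ ῑ) ≫ (ι ≫ ῑ) ◁ z) ⊗≫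
          ι ◁ D.evL ▷ ῑ ⊗≫ ι ◁ D.coevR ▷ ῑ ⊗≫ y ▷ (ι ≫ ῑ) ⊗≫
          (a' ▷ (ι ≫ ῑ) ≫ (ι ≫ ῑ) ◁ w) ⊗≫ ι ◁ D.evL ▷ ῑ ⊗≫ 𝟙 (ι ≫ ῑ) := by
      bicategory
    _ = _ := by
      rw [← whisker_exchange]
      bicategory

section Additive

open PreadditiveBicategory

variable [PreadditiveBicategory C]

theorem fourier_add (x y : ι ≫ ῑ ⟶ ι ≫ ῑ) : D.fourier (x + y) = D.fourier x + D.fourier y := by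
  simp only [fourier, whiskerLeft_add, add_whiskerRight, Preadditive.add_comp, Preadditive.comp_add]

theorem fourierDot_add (x y : ι ≫ ῑ ⟶ ι ≫ ῑ) :
    D.fourierDot (x + y) = D.fourierDot x + D.fourierDot y := by
  simp only [fourierDot, whiskerLeft_add, add_whiskerRight, Preadditive.add_comp,
    Preadditive.comp_add]

theorem mu_add (l l' : ι ⟶ ι) : D.mu (l + l') = D.mu l + D.mu l' := by
  simp only [mu, whiskerLeft_add, add_whiskerRight, Preadditive.add_comp, Preadditive.comp_add]

theorem nu_add (l l' : ι ⟶ ι) : D.nu (l + l') = D.nu l + D.nu l' := by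
  simp only [nu, whiskerLeft_add, add_whiskerRight, Preadditive.add_comp, Preadditive.comp_add]

theorem phiL_add (x y : ι ≫ ῑ ⟶ ι ≫ ῑ) : D.phiL (x + y) = D.phiL x + D.phiL y := by
  simp only [phiL, add_whiskerRight, Preadditive.add_comp, Preadditive.comp_add]

theorem add_convA (x y z : ι ≫ ῑ ⟶ ι ≫ ῑ) : D.convA (x + y) z = D.convA x z + D.convA y z := by
  simp only [convA, add_whiskerRight, Preadditive.add_comp, Preadditive.comp_add]

theorem convA_add (x y z : ι ≫ ῑ ⟶ ι ≫ ῑ) : D.convA x (y + z) = D.convA x y + D.convA x z := by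
  simp only [convA, whiskerLeft_add, Preadditive.add_comp, Preadditive.comp_add]

/-- The Fourier transform as an isomorphism of additive groups. -/
def fourierEquiv : End (ι ≫ ῑ) ≃+ End (ῑ ≫ ι) where
  toFun := D.fourier
  invFun := D.swap.fourierDot
  left_inv := D.swap_fourierDot_fourier
  right_inv := D.fourier_swap_fourierDot
  map_add' := D.fourier_add

/-- The dotted Fourier transform as an isomorphism of additive groups. -/
def fourierDotEquiv : End (ι ≫ ῑ) ≃+ End (ῑ ≫ ι) where
  toFun := D.fourierDot
  invFun := D.swap.fourier
  left_inv := D.swap_fourier_fourierDot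
  right_inv := D.fourierDot_swap_fourier
  map_add' := D.fourierDot_add

/-- The map `μ` as an isomorphism of rings. -/
def muEquiv : End ι ≃+* (End ῑ)ᵐᵒᵖ where
  toFun l := op (D.mu l)
  invFun r := D.swap.nu (unop r)
  left_inv := D.swap.nu_swap_mu
  right_inv r := congrArg op (D.swap.swap_mu_nu (unop r))
  map_add' l l' := congrArg op (D.mu_add l l')
  map_mul' l l' := congrArg op (D.mu_comp l' l)

/-- The map `ν` as an isomorphism of rings. -/
def nuEquiv : End ι ≃+* (End ῑ)ᵐᵒᵖ where
  toFun l := op (D.nu l)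
  invFun r := D.swap.mu (unop r)
  left_inv := D.swap_mu_nu
  right_inv r := congrArg op (D.nu_swap_mu (unop r))
  map_add' l l' := congrArg op (D.nu_add l l')
  map_mul' l l' := congrArg op (D.nu_comp l' l)

/-- Composition and convolution on `End (ι × ῑ)`; the double algebra of `D.swap` is the one on
`End (ῑ × ι)`. -/
def doubleAlgebra : DoubleAlgebra (End (ι ≫ ῑ)) (End ι) (End ῑ) where
  conv := AddMonoidHom.mk' (fun x => AddMonoidHom.mk' (D.convA x) (D.convA_add x))
    fun x y => AddMonoidHom.ext (D.add_convA x y)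
  i := D.iA
  s := RingHom.mk' ⟨⟨fun l => l ▷ ῑ, id_whiskerRight ι ῑ⟩, fun l l' => comp_whiskerRight l' l ῑ⟩
    fun l l' => add_whiskerRight l l' ῑ
  u := RingHom.mk' ⟨⟨fun r => ι ◁ r, whiskerLeft_id ι ῑ⟩, fun r r' => whiskerLeft_comp ι r' r⟩
    (whiskerLeft_add ι)
  μ := D.muEquiv
  ν := D.nuEquiv
  S := D.fourierEquiv.trans D.fourierDotEquiv.symm
  π := AddMonoidHom.mk' (fun x => D.phiL (x * D.iA)) fun x y => by
    rw [add_mul]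
    exact D.phiL_add _ _
  conv_assoc := D.convA_assoc
  conv_i := D.convA_iA
  s_u_comm l r := whisker_exchange l r
  s_mul_conv l x y := D.convA_comp_whiskerRight l x y
  conv_mul_s l x y := D.whiskerRight_comp_convA l x y
  conv_s_mul l x y := D.convA_comp_whiskerRight_right l x y
  s_injective := D.whiskerRight_injective
  s_π x := (D.convA_one (x * D.iA)).symm
  s_π_mul_i x := D.iA_comp_phiL x
  S_mul x y := (congrArg D.swap.fourier (D.fourier_comp y x)).trans (D.swap.fourier_convA _ _)
  S_conv x y := (congrArg D.swap.fourier (D.fourier_convA x y)).trans (D.swap.fourier_comp _ _)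
  S_u l := D.fourierDot_injective <|
    (D.fourierDot_swap_fourier _).trans (D.fourier_whiskerLeft_mu l)
  S_s l := D.fourierDot_injective <|
    (D.fourierDot_swap_fourier _).trans (D.fourier_whiskerRight l)

end Additive

end FourierTransform

open PreadditiveBicategory

section Mates

variable {C : Type u} [Bicategory.{w, v} C] {a b : C} {ι : a ⟶ b} {ῑ : b ⟶ a}
  (D : TwoSidedDual ι ῑ)

theorem quasiBasisTerm_eq (y x : ι ≫ ῑ ⟶ ι ≫ ῑ) :
    x ▷ ι ≫ (α_ ι ῑ ι).hom ≫ ι ◁ D.evL ≫ ι ◁ D.coevR ≫ (α_ ι ῑ ι).inv ≫ y ▷ ι =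
      D.left.homEquiv₂.symm x ≫ D.right.homEquiv₂ y := by
  rw [Adjunction.homEquiv₂_apply, Adjunction.homEquiv₂_symm_apply]
  dsimp only [evL, coevR]
  bicategory

/-- The adjunction `ῑ × (ι × ῑ) ⊣ (ι × ῑ) × ι` obtained by composing the two dualities. -/
def tripleAdjunction : Bicategory.Adjunction (ῑ ≫ (ι ≫ ῑ)) ((ι ≫ ῑ) ≫ ι) :=
  D.right.comp (D.left.comp D.right)

theorem left_homEquiv₂_fourier (w : ι ≫ ῑ ⟶ ι ≫ ῑ) :
    D.left.homEquiv₂ (D.fourier w) =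
      𝟙 ῑ ⊗≫ D.coevR ▷ ῑ ⊗≫ ῑ ◁ w ⊗≫ 𝟙 ((ῑ ≫ ι) ≫ ῑ) := by
  rw [Adjunction.homEquiv₂_apply]
  dsimp only [fourier, evL, coevR]
  calc
    _ = 𝟙 ῑ ⊗≫ (𝟙 b ◁ (ῑ ◁ D.left.unit) ≫ D.right.unit ▷ (ῑ ≫ ι ≫ ῑ)) ⊗≫
          ῑ ◁ (w ▷ (ι ≫ ῑ)) ⊗≫ ῑ ◁ ι ◁ D.left.counit ▷ ῑ ⊗≫ 𝟙 ((ῑ ≫ ι) ≫ ῑ) := by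
      bicategory
    _ = 𝟙 ῑ ⊗≫ D.right.unit ▷ ῑ ⊗≫ ῑ ◁ ((ι ≫ ῑ) ◁ D.left.unit ≫ w ▷ (ι ≫ ῑ)) ⊗≫
          ῑ ◁ ι ◁ D.left.counit ▷ ῑ ⊗≫ 𝟙 ((ῑ ≫ ι) ≫ ῑ) := by
      rw [whisker_exchange]
      bicategory
    _ = 𝟙 ῑ ⊗≫ D.right.unit ▷ ῑ ⊗≫ ῑ ◁ w ⊗≫
          ῑ ◁ ι ◁ rightZigzag D.left.unit D.left.counit ⊗≫ 𝟙 ((ῑ ≫ ι) ≫ ῑ) := by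
      rw [whisker_exchange]
      bicategory
    _ = _ := by
      rw [D.left.right_triangle]
      bicategory

theorem conjugateEquiv_symm_left_homEquiv₂_symm (x : ι ≫ ῑ ⟶ ι ≫ ῑ) :
    (Bicategory.conjugateEquiv D.tripleAdjunction D.right).symm (D.left.homEquiv₂.symm x) =
      D.left.homEquiv₂ (D.fourier (D.swap.fourier (D.fourier x))) ≫ (α_ ῑ ι ῑ).hom := by
  rw [left_homEquiv₂_fourier, Bicategory.conjugateEquiv_symm_apply',
    Adjunction.homEquiv₂_symm_apply]
  dsimp only [tripleAdjunction, Bicategory.Adjunction.comp, Adjunction.compUnit, fourier, swap, evL,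
    coevR]
  bicategory

theorem conjugateEquiv_symm_right_homEquiv₂ (y : ι ≫ ῑ ⟶ ι ≫ ῑ) :
    (Bicategory.conjugateEquiv D.right D.tripleAdjunction).symm (D.right.homEquiv₂ y) =
      (α_ ῑ ι ῑ).inv ≫ D.right.homEquiv₂.symm (D.fourier y) := by
  rw [Bicategory.conjugateEquiv_symm_apply', Adjunction.homEquiv₂_symm_apply,
    Adjunction.homEquiv₂_apply]
  dsimp only [tripleAdjunction, Bicategory.Adjunction.comp, Adjunction.compCounit, fourier, evL,
    coevR]
  calc
    _ = 𝟙 (ῑ ≫ (ι ≫ ῑ)) ⊗≫ D.right.unit ▷ (ῑ ≫ ι ≫ ῑ) ⊗≫ ῑ ◁ ι ◁ D.right.unit ▷ ῑ ▷ ι ▷ ῑ ⊗≫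
          ῑ ◁ (y ▷ (ι ≫ ῑ) ≫ (ι ≫ ῑ) ◁ D.right.counit) ▷ (ι ≫ ῑ) ⊗≫
          ῑ ◁ ι ◁ D.left.counit ▷ ῑ ⊗≫ ῑ ◁ D.right.counit ⊗≫ 𝟙 ῑ := by
      bicategory
    _ = 𝟙 (ῑ ≫ (ι ≫ ῑ)) ⊗≫ D.right.unit ▷ (ῑ ≫ ι ≫ ῑ) ⊗≫
          ῑ ◁ ι ◁ leftZigzag D.right.unit D.right.counit ▷ (ι ≫ ῑ) ⊗≫
          ῑ ◁ y ▷ (ι ≫ ῑ) ⊗≫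
          ῑ ◁ ι ◁ D.left.counit ▷ ῑ ⊗≫ ῑ ◁ D.right.counit ⊗≫ 𝟙 ῑ := by
      rw [← whisker_exchange]
      bicategory
    _ = _ := by
      rw [D.right.left_triangle]
      bicategory

end Mates

section QuasiBasis

variable {C : Type u} [Bicategory.{w, v} C] [PreadditiveBicategory C] {a b : C} {ι : a ⟶ b}
  {ῑ : b ⟶ a} {D : TwoSidedDual ι ῑ} {n : ℕ} {y x : Fin n → End (ι ≫ ῑ)}

theorem IsQuasiBasis.sum_convA_comp_convA (h : D.IsQuasiBasis y x) (a' c z w : ι ≫ ῑ ⟶ ι ≫ ῑ) :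
    ∑ k, D.convA (c ≫ x k) z ≫ D.convA (y k ≫ a') w = D.convA (c ≫ a') (z ≫ w) := by
  calc
    _ = 𝟙 (ι ≫ ῑ) ⊗≫ ι ◁ D.coevR ▷ ῑ ⊗≫ (c ▷ (ι ≫ ῑ) ≫ (ι ≫ ῑ) ◁ z) ⊗≫
        (∑ k, (x k ▷ ι ≫ (α_ ι ῑ ι).hom ≫ ι ◁ D.evL ≫ ι ◁ D.coevR ≫ (α_ ι ῑ ι).inv ≫
          y k ▷ ι)) ▷ ῑ ⊗≫
          (a' ▷ (ι ≫ ῑ) ≫ (ι ≫ ῑ) ◁ w) ⊗≫ ι ◁ D.evL ▷ ῑ ⊗≫ 𝟙 (ι ≫ ῑ) := by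
      simp only [convA_comp_convA, PreadditiveBicategory.sum_whiskerRight, bicategoricalComp,
        Preadditive.comp_sum, Preadditive.sum_comp]
    _ = 𝟙 (ι ≫ ῑ) ⊗≫ ι ◁ D.coevR ▷ ῑ ⊗≫ c ▷ (ι ≫ ῑ) ⊗≫ ((ι ≫ ῑ) ◁ z ≫ a' ▷ (ι ≫ ῑ)) ⊗≫
          (ι ≫ ῑ) ◁ w ⊗≫ ι ◁ D.evL ▷ ῑ ⊗≫ 𝟙 (ι ≫ ῑ) := by
      rw [h]
      bicategory
    _ = _ := by
      rw [whisker_exchange]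
      dsimp only [convA]
      bicategory

theorem isQuasiBasis_iff : D.IsQuasiBasis y x ↔
    ∑ k, D.left.homEquiv₂.symm (x k) ≫ D.right.homEquiv₂ (y k) = 𝟙 ((ι ≫ ῑ) ≫ ι) := by
  simp only [IsQuasiBasis, quasiBasisTerm_eq]

theorem IsQuasiBasis.swap (h : D.IsQuasiBasis y x) :
    D.swap.IsQuasiBasis (fun k => D.fourier (D.swap.fourier (D.fourier (x k))))
      fun k => D.fourier (y k) := by
  let conj := Bicategory.conjugateEquiv D.tripleAdjunction D.tripleAdjunction
  have conj_add (θ θ' : (ι ≫ ῑ) ≫ ι ⟶ (ι ≫ ῑ) ≫ ι) :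
      conj.symm (θ + θ') = conj.symm θ + conj.symm θ' := by
    simp only [conj, Bicategory.conjugateEquiv_symm_apply', whiskerLeft_add, add_whiskerRight,
      Preadditive.add_comp, Preadditive.comp_add]
  have conj_term (k : Fin n) :
      conj.symm (D.left.homEquiv₂.symm (x k) ≫ D.right.homEquiv₂ (y k)) =
        (α_ ῑ ι ῑ).inv ≫ (D.right.homEquiv₂.symm (D.fourier (y k)) ≫
          D.left.homEquiv₂ (D.fourier (D.swap.fourier (D.fourier (x k))))) ≫ (α_ ῑ ι ῑ).hom := by
    rw [← Bicategory.conjugateEquiv_symm_comp D.tripleAdjunction D.right D.tripleAdjunction,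
      conjugateEquiv_symm_left_homEquiv₂_symm, conjugateEquiv_symm_right_homEquiv₂]
    simp only [Category.assoc]
  have sum_conj := congrArg (AddMonoidHom.mk' conj.symm conj_add) (isQuasiBasis_iff.1 h)
  rw [map_sum, AddMonoidHom.mk'_apply, Bicategory.conjugateEquiv_symm_id] at sum_conj
  simp only [conj_term, ← Preadditive.comp_sum, ← Preadditive.sum_comp, Iso.inv_comp_eq,
    Category.comp_id] at sum_conj
  exact isQuasiBasis_iff.2 ((cancel_mono_id (α_ ῑ ι ῑ).hom).1 sum_conj)

theorem IsQuasiBasis.isRightCasimir (h : D.IsQuasiBasis y x) :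
    D.doubleAlgebra.IsRightCasimir (fun k => D.doubleAlgebra.S (x k)) y := fun a' c z w =>
  D.fourierEquiv.injective <| by
    change D.fourierEquiv (∑ k, D.convA (D.convA a' (D.swap.fourier (D.fourier (x k))) ≫ z)
      (D.convA (y k) c ≫ w)) = D.fourier (D.convA a' c ≫ D.convA z w)
    rw [map_sum, fourier_comp, fourier_convA, fourier_convA,
      ← h.swap.sum_convA_comp_convA (D.fourier a') (D.fourier c) (D.fourier w) (D.fourier z)]
    refine Finset.sum_congr rfl fun k _ => (D.fourier_convA _ _).trans ?_
    simp only [fourier_comp, fourier_convA]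

theorem IsQuasiBasis.isLeftCasimir (h : D.IsQuasiBasis y x) :
    D.doubleAlgebra.IsLeftCasimir (fun k => D.doubleAlgebra.S.symm (y k)) x := by
  simpa only [Function.comp_def, AddEquiv.symm_apply_apply]
    using h.isRightCasimir.isLeftCasimir_S_symm

theorem IsQuasiBasis.sum_mul_convA (h : D.IsQuasiBasis y x) (c : ι ≫ ῑ ⟶ ι ≫ ῑ) :
    ∑ k, D.convA (x k) c ≫ y k = D.convA (𝟙 (ι ≫ ῑ)) (c ≫ D.iA) := by
  simpa only [Category.id_comp, Category.comp_id, convA_iA]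
    using h.sum_convA_comp_convA (𝟙 (ι ≫ ῑ)) (𝟙 (ι ≫ ῑ)) c D.iA

/-- The Hopf algebroid of a D2 quasi-basis on `A = End (ι × ῑ)`. -/
def IsQuasiBasis.hopfAlgebroid (h : D.IsQuasiBasis y x) :
    HopfAlgebroid (End (ι ≫ ῑ)) (End ι) (End ῑ) :=
  h.isLeftCasimir.hopfAlgebroid h.isRightCasimir fun c => by
    simp only [AddEquiv.apply_symm_apply]
    exact h.sum_mul_convA c

theorem IsQuasiBasis.isLeftCasimir_fourier (h : D.IsQuasiBasis y x) :
    D.swap.doubleAlgebra.IsLeftCasimir (fun k => D.fourier (x k)) fun k => D.fourier (y k) := by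
  have S_symm (k : Fin n) : D.swap.doubleAlgebra.S.symm
      (D.fourier (D.swap.fourier (D.fourier (x k)))) = D.fourier (x k) :=
    D.swap.doubleAlgebra.S.symm_apply_apply (D.fourier (x k))
  simpa only [S_symm] using h.swap.isLeftCasimir

theorem IsQuasiBasis.isRightCasimir_fourierDot (h : D.IsQuasiBasis y x) :
    D.swap.doubleAlgebra.IsRightCasimir (fun k => D.fourierDot (y k))
      fun k => D.fourierDot (x k) := by
  have S_symm (z : End (ι ≫ ῑ)) :
      D.swap.doubleAlgebra.S.symm (D.fourier z) = D.fourierDot z :=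
    congrArg D.fourierDot (D.swap_fourierDot_fourier z)
  simpa only [Function.comp_def, S_symm] using h.isLeftCasimir_fourier.isRightCasimir_S_symm

/-- The Hopf algebroid of a D2 quasi-basis on `B = End (ῑ × ι)`. -/
def IsQuasiBasis.swapHopfAlgebroid (h : D.IsQuasiBasis y x) :
    HopfAlgebroid (End (ῑ ≫ ι)) (End ῑ) (End ι) :=
  h.isLeftCasimir_fourier.hopfAlgebroid h.isRightCasimir_fourierDot h.swap.sum_mul_convA

end QuasiBasis

section Depth

variable {C : Type u} [Bicategory.{w, v} C] [AdditiveBicategory C] {a b : C} {ι : a ⟶ b}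
  {ῑ : b ⟶ a}

theorem exists_isQuasiBasis (D : TwoSidedDual ι ῑ) (h : IsLeftD2 ι ῑ) :
    ∃ (n : ℕ) (y x : Fin n → End (ι ≫ ῑ)), D.IsQuasiBasis y x := by
  obtain ⟨n, ⟨r⟩⟩ := h
  refine ⟨n, fun k => D.right.homEquiv₂.symm (biproduct.ι (fun _ => ι) k ≫ r.r),
    fun k => D.left.homEquiv₂ (r.i ≫ biproduct.π (fun _ => ι) k), isQuasiBasis_iff.2 ?_⟩
  calc
    _ = r.i ≫ (∑ k, biproduct.π (fun _ => ι) k ≫ biproduct.ι (fun _ => ι) k) ≫ r.r := by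
      simp only [Equiv.symm_apply_apply, Equiv.apply_symm_apply, Preadditive.sum_comp,
        Preadditive.comp_sum, Category.assoc]
    _ = _ := by rw [biproduct.total, Category.id_comp, r.retract]

theorem IsQuasiBasis.isLeftD2 {D : TwoSidedDual ι ῑ} {n : ℕ} {y x : Fin n → End (ι ≫ ῑ)}
    (h : D.IsQuasiBasis y x) : IsLeftD2 ι ῑ :=
  ⟨n, ⟨⟨biproduct.lift fun k => D.left.homEquiv₂.symm (x k),
    biproduct.desc fun k => D.right.homEquiv₂ (y k),
    biproduct.lift_desc.trans (isQuasiBasis_iff.1 h)⟩⟩⟩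

theorem isD2_of_isLeftD2 (D : TwoSidedDual ι ῑ) (h : IsLeftD2 ι ῑ) : IsD2 ι ῑ :=
  have ⟨_, _, _, quasiBasis⟩ := D.exists_isQuasiBasis h
  ⟨h, quasiBasis.swap.isLeftD2⟩

end Depth

section Counits

variable {C : Type u} [Bicategory.{w, v} C] [PreadditiveBicategory C] {a b : C} {ι : a ⟶ b}
  {ῑ : b ⟶ a} (D : TwoSidedDual ι ῑ)

theorem swap_π_fourier (x : End (ι ≫ ῑ)) :
    D.swap.doubleAlgebra.π (D.fourier x) = D.nu (D.phiL x) :=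
  D.swap.doubleAlgebra.s_injective <| calc
    _ = D.swap.convA (D.swap.iA ≫ D.fourier x) (𝟙 (ῑ ≫ ι)) := D.swap.doubleAlgebra.s_π _
    _ = D.swap.convA (D.fourier (D.convA x (𝟙 (ι ≫ ῑ)))) (D.fourier D.iA) := by
      rw [fourier_convA, fourier_one, fourier_iA]
    _ = D.fourier (D.phiL x ▷ ῑ ≫ D.iA) := by rw [← fourier_comp, convA_one]
    _ = D.fourier (ι ◁ D.nu (D.phiL x) ≫ D.iA) :=
      congrArg D.fourier (D.doubleAlgebra.i_mul_u_ν (D.phiL x)).symm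
    _ = D.nu (D.phiL x) ▷ ι := by rw [fourier_whiskerLeft_comp, fourier_iA, Category.comp_id]

theorem swap_πR_fourierDot (x : End (ι ≫ ῑ)) :
    D.swap.doubleAlgebra.πR (D.fourierDot x) = D.phiL x :=
  D.swap.doubleAlgebra.u_injective <| calc
    _ = D.swap.convA (𝟙 (ῑ ≫ ι)) (D.fourierDot x ≫ D.swap.iA) := D.swap.doubleAlgebra.u_πR _
    _ = D.swap.convA (D.fourierDot D.iA) (D.fourierDot (D.convA x (𝟙 (ι ≫ ῑ)))) := by
      rw [fourierDot_convA, fourierDot_one, fourierDot_iA]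
    _ = D.fourierDot (D.phiL x ▷ ῑ ≫ D.iA) := by rw [← fourierDot_comp, convA_one]
    _ = ῑ ◁ D.phiL x := by
      rw [fourierDot_whiskerRight_comp, fourierDot_iA, Category.comp_id]

end Counits

end TwoSidedDual

theorem mainTheorem1 {C : Type u} [Bicategory.{w, v} C] [AdditiveBicategory C] {a b : C}
    (ι : a ⟶ b) (ῑ : b ⟶ a) (D : TwoSidedDual ι ῑ) (hD2 : IsLeftD2 ι ῑ) :
    -- the Fourier transforms and `μ`, `ν` are isomorphisms
    ∃ (F Fdot : End (ι ≫ ῑ) ≃+ End (ῑ ≫ ι)) (μ ν : End ι ≃+* (End ῑ)ᵐᵒᵖ),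
      (∀ x, F x = D.fourier x) ∧ (∀ x, Fdot x = D.fourierDot x) ∧
      (∀ l, μ l = op (D.mu l)) ∧ (∀ l, ν l = op (D.nu l)) ∧
      -- `ι` is D2, there are quasi-bases, and each of them yields the two Hopf algebroids
      IsD2 ι ῑ ∧
      (∃ (n : ℕ) (y x : Fin n → End (ι ≫ ῑ)), D.IsQuasiBasis y x) ∧
      ∀ (n : ℕ) (y x : Fin n → End (ι ≫ ῑ)), D.IsQuasiBasis y x →
        (∃ H : HopfAlgebroid (End (ι ≫ ῑ)) (End ι) (End ῑ),
          (∀ l, H.left.s l = l ▷ ῑ) ∧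
          (∀ l, H.left.t (op l) = ι ◁ D.mu l) ∧
          (∀ z, H.left.γ z = ∑ i, Bal.tmul (D.convA z (H.S.symm (y i))) (x i)) ∧
          (∀ z, H.left.γ z = ∑ i, Bal.tmul (H.S.symm (y i)) (D.convA (x i) z)) ∧
          (∀ z, H.left.π z = D.phiL (z * D.iA)) ∧
          (∀ r, H.right.s r = ι ◁ r) ∧
          (∀ r, H.right.t (op r) = ν.symm (op r) ▷ ῑ) ∧
          (∀ z, H.right.γ z = ∑ i, Bal.tmul (D.convA z (H.S (x i))) (y i)) ∧
          (∀ z, H.right.γ z = ∑ i, Bal.tmul (H.S (x i)) (D.convA (y i) z)) ∧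
          (∀ z, H.right.π z = D.nu (D.phiL (H.S.symm z * D.iA))) ∧
          (∀ z, H.S z = Fdot.symm (F z))) ∧
        (∃ H : HopfAlgebroid (End (ῑ ≫ ι)) (End ῑ) (End ι),
          (∀ r, H.left.s r = r ▷ ι) ∧
          (∀ r, H.left.t (op r) = ῑ ◁ ν.symm (op r)) ∧
          (∀ z, H.left.γ z = ∑ i, Bal.tmul (D.convB z (F (x i))) (F (y i))) ∧
          (∀ z, H.left.γ z = ∑ i, Bal.tmul (F (x i)) (D.convB (F (y i)) z)) ∧
          (∀ z, H.left.π z = D.nu (D.phiL (F.symm z))) ∧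
          (∀ l, H.right.s l = ῑ ◁ l) ∧
          (∀ l, H.right.t (op l) = D.mu l ▷ ι) ∧
          (∀ z, H.right.γ z = ∑ i, Bal.tmul (D.convB z (Fdot (y i))) (Fdot (x i))) ∧
          (∀ z, H.right.γ z = ∑ i, Bal.tmul (Fdot (y i)) (D.convB (Fdot (x i)) z)) ∧
          (∀ z, H.right.π z = D.phiL (Fdot.symm z)) ∧
          (∀ z, H.S z = F (Fdot.symm z))) := by
  refine ⟨D.fourierEquiv, D.fourierDotEquiv, D.muEquiv, D.nuEquiv, fun _ => rfl, fun _ => rfl,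
    fun _ => rfl, fun _ => rfl, D.isD2_of_isLeftD2 hD2, D.exists_isQuasiBasis hD2, fun n y x h =>
    ⟨⟨h.hopfAlgebroid, ?_⟩, ⟨h.swapHopfAlgebroid, ?_⟩⟩⟩
  · exact ⟨fun _ => rfl, fun _ => rfl, D.doubleAlgebra.coproductL_apply _ _,
      h.isLeftCasimir.coproductL_apply', fun _ => rfl, fun _ => rfl, fun _ => rfl,
      D.doubleAlgebra.coproductR_apply _ _, h.isRightCasimir.coproductR_apply', fun _ => rfl,
      fun _ => rfl⟩
  · simp only [D.convB_eq_swap_convA]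
    refine ⟨fun _ => rfl, fun _ => rfl, D.swap.doubleAlgebra.coproductL_apply _ _,
      h.isLeftCasimir_fourier.coproductL_apply', D.fourierEquiv.surjective.forall.2 fun z => ?_,
      fun _ => rfl, fun _ => rfl, D.swap.doubleAlgebra.coproductR_apply _ _,
      h.isRightCasimir_fourierDot.coproductR_apply',
      D.fourierDotEquiv.surjective.forall.2 fun z => ?_, fun _ => rfl⟩
    · rw [AddEquiv.symm_apply_apply]
      exact D.swap_π_fourier z
    · rw [AddEquiv.symm_apply_apply]
      exact D.swap_πR_fourierDot z
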